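/- **Setting.** Let $V$ be a separable real Banach space, $T\in\mathbb N$, $I=\{0,1,\dots,T\}$, $r\ge 0$. Write $(I\to Y)$ for the set of paths $Y^I$ with the product topology and its Borel $\sigma$-algebra. *Adapted processes.* $\mathcal S(V)$ is the class of adapted processes $\mathbf X=(\Omega,\mathbb P,(\mathcal F_t)_{t\in I},X)$: a filtered probability space with a map $X:\Omega\to(I\to V)$ such that $X_t$ is $\mathcal F_t$-measurable for all $t\in I$ (different processes may live on different filtered probability spaces). Put $\operatorname{Prob}_0(V)=V$ and let $\operatorname{Prob}_{k+1}(V)$ be the space of Borel probability measures on $(I\to\operatorname{Prob}_k(V))$ with the weak topology. The prediction processes of $\mathbf X$ are $\hat X^0=X$ and $\hat X^{k+1}_t=\mathbb P(\hat X^k\in\cdot\mid\mathcal F_t)$ (regular conditional laws), $t\in I$, so that $\operatorname{Law}(\hat X^k)\in\operatorname{Prob}_{k+1}(V)$. The extended weak topology $\hat\tau_r$ on $\mathcal S(V)$ is the initial topology of $\mathbf X\mapsto\operatorname{Law}(\hat X^r)$; thus $\mathbf X^n\to\mathbf X$ in $\hat\tau_r$ iff $\mathbb E f(\hat X^{n,r})\to\mathbb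 E f(\hat X^r)$ for all bounded continuous $f:(I\to\operatorname{Prob}_r(V))\to\mathbb R$. *Tensor algebras.* For a Banach space $W$ let $E=\mathbb R\oplus W$ with norm $|s|+\|w\|$. An admissible family of norms on $(E^{\otimes m})_{m\ge0}$ consists of norms on the algebraic tensor powers such that: they are $|\cdot|$ on $E^{\otimes 0}=\mathbb R$ and the given norm on $E^{\otimes 1}=E$; $\|v_1\otimes\dots\otimes v_m\|=\|v_{\sigma(1)}\otimes\dots\otimes v_{\sigma(m)}\|$ for all permutations $\sigma$; $\|a\otimes b\|\le\|a\|\,\|b\|$ for $a\in E^{\otimes m}$, $b\in E^{\otimes n}$; and every functional $\ell_1\otimes\dots\otimes\ell_m$ with $\ell_i$ in the dual of $E$ is continuous on $E^{\otimes m}$ (e.g. projective or injective norms). Given such a family, $\mathbf T^1(W)$ is the completion of $\bigoplus_m E^{\otimes m}$ under $\|t\|=\sum_m\|t_m\|$. The signature of $x\in(I\to W)$ is $$\mathrm S(x)=\exp(\Delta_0x)\cdot\exp(\Delta_1x)\cdots\exp(\Delta_Tx)\in\mathbf T^1(W),$$ where $\Delta_0x=(1,x(0))$, $\Delta_tx=(1,x(t)-x(t-1))$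 for $t\ge1$, $\exp(v)=(v^{\otimes m}/m!)_{m\ge0}$ and $(s\cdot t)_m=\sum_{i+j=m}s_i\otimes t_j$. A tensor normalization is a continuous, injective map $\Lambda:\{t\in\mathbf T^1(W):t_0=1\}\to\mathbf T^1(W)$ with bounded range of the form $\Lambda(t)=(\lambda(t)^mt_m)_{m\ge0}$ for some function $\lambda>0$. *The distance.* Put $\mathbf T^0(V)=V$ and $\mathbf T^{k+1}(V)=\mathbf T^1(\mathbf T^k(V))$, where for every $k$ an arbitrary admissible family of norms on the tensor powers of $\mathbb R\oplus\mathbf T^k(V)$ and an arbitrary tensor normalization $\Lambda_k$ on $\{t\in\mathbf T^{k+1}(V):t_0=1\}$ have been fixed. The robust expected signatures $\bar{\mathrm S}_k:\operatorname{Prob}_k(V)\to\mathbf T^k(V)$ are $\bar{\mathrm S}_0=\mathrm{id}_V$ and $$\bar{\mathrm S}_{k+1}(\mu)=\int\Lambda_k\big(\mathrm S\big(t\mapsto\bar{\mathrm S}_k(x(t))\big)\big)\,\mu(dx).$$ Finally $\Phi_r(\mathbf X)=\bar{\mathrm S}_{r+1}(\operatorname{Law}(\hat X^r))$ and $d_r(\mathbf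 X,\mathbf Y)=\|\Phi_r(\mathbf X)-\Phi_r(\mathbf Y)\|_{\mathbf T^{r+1}(V)}$. **Proposition.** Let $(\mathbf X^n)_{n\ge0}\subset\mathcal S(V)$ and $\mathbf X\in\mathcal S(V)$. 1. If $\mathbf X^n\to\mathbf X$ in $(\mathcal S(V),\hat\tau_r)$, then $d_r(\mathbf X^n,\mathbf X)\to0$ as $n\to\infty$. 2. If $(\mathbf X^n)_{n\ge0}$ is contained in a compact set of $(\mathcal S(V),\hat\tau_r)$, then $d_r(\mathbf X^n,\mathbf X)\to0$ as $n\to\infty$ implies that $\mathbf X^n\to\mathbf X$ in $(\mathcal S(V),\hat\tau_r)$. -/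

import Mathlib

open MeasureTheory ProbabilityTheory Filter Topology
open scoped TensorProduct Nat

universe u w

noncomputable section

/-! ## Paths and rank `r` probability measures -/

/-- Paths `(I → Y)` indexed by `I = {0, 1, …, T}`, with the product topology and its Borel
σ-algebra. -/
def DPath (T : ℕ) (Y : Type u) : Type u := Fin (T + 1) → Y

instance DPath.instTopologicalSpace (T : ℕ) (Y : Type u) [TopologicalSpace Y] :
    TopologicalSpace (DPath T Y) :=
  inferInstanceAs (TopologicalSpace (Fin (T + 1) → Y))

instance DPath.instMeasurableSpace (T : ℕ) (Y : Type u) [TopologicalSpace Y] :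
    MeasurableSpace (DPath T Y) :=
  borel (DPath T Y)

instance DPath.instBorelSpace (T : ℕ) (Y : Type u) [TopologicalSpace Y] :
    BorelSpace (DPath T Y) :=
  ⟨rfl⟩

/-- The spaces `Prob_r(V)` as topological spaces: `Prob_0(V) = V`, and
`Prob_{r+1}(V) = Prob(I → Prob_r(V))` is the set of Borel probability measures on paths in
`Prob_r(V)`, with the weak topology. -/
def rankProb (T : ℕ) (V : Type u) [TopologicalSpace V] : ℕ → TopCat.{u}
  | 0 => TopCat.of V
  | r + 1 => TopCat.of (ProbabilityMeasure (DPath T (rankProb T V r)))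

instance rankProb.instNonempty (T : ℕ) (V : Type u) [TopologicalSpace V] [Nonempty V] :
    (r : ℕ) → Nonempty (rankProb T V r)
  | 0 => inferInstanceAs (Nonempty V)
  | r + 1 =>
    let x : DPath T (rankProb T V r) := fun _ => (rankProb.instNonempty T V r).some
    ⟨(⟨Measure.dirac x, inferInstance⟩ : ProbabilityMeasure (DPath T (rankProb T V r)))⟩

/-! ## Adapted processes, prediction processes, extended weak topologies -/

/-- Adapted stochastic processes `(Ω, ℙ, (𝓕_t)_{t ∈ I}, X)` in discrete time `I = {0, …, T}` with
state space `V` (carrying its Borel σ-algebra). -/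
structure AdaptedProcess (T : ℕ) (V : Type u) [TopologicalSpace V] where
  /-- the sample space -/
  Ω : Type w
  /-- the ambient σ-algebra -/
  mΩ : MeasurableSpace Ω
  /-- the probability measure -/
  prob : Measure Ω
  isProb : IsProbabilityMeasure prob
  /-- the filtration -/
  filtration : Filtration (Fin (T + 1)) mΩ
  /-- the process, as a random path -/
  X : Ω → DPath T V
  adapted : ∀ t, Measurable[filtration t, borel V] (fun ω => X ω t)

attribute [instance] AdaptedProcess.mΩ AdaptedProcess.isProb

/-- `κ` is a regular version of the conditional law `P(Z ∈ · | m)`: it is measurable from `m` to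
the Borel σ-algebra of the weak topology, and `κ(B) = P(Z ∈ B | m)` almost surely for every Borel
set `B`. -/
def IsCondLaw {Ω : Type w} {mΩ : MeasurableSpace Ω} (P : Measure Ω) (m : MeasurableSpace Ω)
    {S : Type u} [TopologicalSpace S] [MeasurableSpace S] [BorelSpace S]
    (Z : Ω → S) (κ : Ω → ProbabilityMeasure S) : Prop :=
  Measurable[m, borel (ProbabilityMeasure S)] κ ∧
    ∀ B : Set S, MeasurableSet B →
      (fun ω => (κ ω : Measure S).real B) =ᵐ[P] P⟦Z ⁻¹' B | m⟧

namespace AdaptedProcess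

variable {T : ℕ} {V : Type u} [TopologicalSpace V]

/-- `Y` is a version of the path `t ↦ P(Z ∈ · | 𝓕_t)` of conditional laws of `Z`. -/
def IsPrediction (A : AdaptedProcess.{u, w} T V) {S : Type u} [TopologicalSpace S]
    [MeasurableSpace S] [BorelSpace S] (Z : A.Ω → S)
    (Y : A.Ω → DPath T (ProbabilityMeasure S)) : Prop :=
  Measurable Y ∧ ∀ t, IsCondLaw A.prob (A.filtration t) Z (fun ω => Y ω t)

theorem measurable_X [SecondCountableTopology V] (A : AdaptedProcess.{u, w} T V) :
    Measurable A.X := by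
  let _ : MeasurableSpace V := borel V
  have : BorelSpace V := ⟨rfl⟩
  have h : (MeasurableSpace.pi : MeasurableSpace (Fin (T + 1) → V)) =
      borel (Fin (T + 1) → V) := BorelSpace.measurable_eq
  have hX : @Measurable A.Ω (Fin (T + 1) → V) A.mΩ MeasurableSpace.pi A.X :=
    measurable_pi_lambda _ fun t => (A.adapted t).mono (A.filtration.le t) le_rfl
  rw [h] at hX
  exact hX

open Classical in
/-- The rank `r` prediction process, as a random path in `Prob_r(V)`: `X̂⁰ = X` and
`X̂^{r+1}_t = P(X̂^r ∈ · | 𝓕_t)`. For `V` Polish all the spaces `Prob_r(V)` are Polish, so that a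
regular version exists; one is chosen (any two agree almost surely). The last branch only makes the
definition total on spaces where there is no version. -/
def prediction [SecondCountableTopology V] [Nonempty V] (A : AdaptedProcess.{u, w} T V) :
    (r : ℕ) → {Z : A.Ω → DPath T (rankProb T V r) // Measurable Z}
  | 0 => ⟨A.X, A.measurable_X⟩
  | r + 1 =>
    if h : ∃ Y : A.Ω → DPath T (ProbabilityMeasure (DPath T (rankProb T V r))),
        A.IsPrediction (prediction A r).1 Y then
      ⟨h.choose, h.choose_spec.1⟩
    else
      ⟨fun _ _ => Classical.arbitrary (rankProb T V (r + 1)), measurable_const⟩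

/-- The law of `X̂^r`, an element of `Prob(I → Prob_r(V)) = Prob_{r+1}(V)`. -/
def predictionLaw [SecondCountableTopology V] [Nonempty V] (A : AdaptedProcess.{u, w} T V)
    (r : ℕ) : ProbabilityMeasure (DPath T (rankProb T V r)) :=
  ⟨A.prob.map (A.prediction r).1,
    Measure.isProbabilityMeasure_map (A.prediction r).2.aemeasurable⟩

end AdaptedProcess

/-- The extended weak topology of rank `r` on adapted processes: the topology of weak convergence
of the laws of the rank `r` prediction processes. -/
abbrev extendedWeakTopology (T : ℕ) (V : Type u) [TopologicalSpace V] [SecondCountableTopology V]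
    [Nonempty V] (r : ℕ) : TopologicalSpace (AdaptedProcess.{u, w} T V) :=
  TopologicalSpace.induced (fun A => A.predictionLaw r) inferInstance

/-! ## Tensor algebras -/

/-- An admissible family of norms on the tensor powers `E^{⊗m}` of a normed space `E`. -/
structure AdmissibleNorms (E : Type u) [NormedAddCommGroup E] [NormedSpace ℝ E] where
  /-- the norm on `E^{⊗m}` -/
  nrm : (m : ℕ) → Seminorm ℝ (⨂[ℝ]^m E)
  eq_zero : ∀ m (a : ⨂[ℝ]^m E), nrm m a = 0 → a = 0
  /-- on `E^{⊗0} = ℝ` it is the absolute value -/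
  nrm_zero : ∀ c : ℝ, nrm 0 (TensorPower.algebraMap₀ c) = |c|
  /-- on `E^{⊗1} = E` it is the given norm -/
  nrm_one : ∀ v : E, nrm 1 (PiTensorProduct.tprod ℝ fun _ => v) = ‖v‖
  nrm_perm : ∀ m (s : Equiv.Perm (Fin m)) (v : Fin m → E),
    nrm m (PiTensorProduct.tprod ℝ fun i => v (s i)) = nrm m (PiTensorProduct.tprod ℝ v)
  nrm_mul_le : ∀ m n (a : ⨂[ℝ]^m E) (b : ⨂[ℝ]^n E),
    nrm (m + n) (TensorPower.mulEquiv (a ⊗ₜ[ℝ] b)) ≤ nrm m a * nrm n b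
  /-- the elementary functionals `ℓ₁ ⊗ ⋯ ⊗ ℓ_m`, with `ℓ_i` in the dual of `E`, are continuous -/
  continuous_elementary : ∀ m (l : Fin m → (E →L[ℝ] ℝ)), ∃ C : ℝ, ∀ a : ⨂[ℝ]^m E,
    |PiTensorProduct.lift ((MultilinearMap.mkPiAlgebra ℝ (Fin m) ℝ).compLinearMap
      fun i => (l i : E →ₗ[ℝ] ℝ)) a| ≤ C * nrm m a

section TensorAlgebra

variable {E : Type u} [NormedAddCommGroup E] [NormedSpace ℝ E]

/-- The `m`-th tensor power of `E`, normed by an admissible family of norms. -/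
def TensorPow (_N : AdmissibleNorms E) (m : ℕ) : Type u := ⨂[ℝ]^m E

instance TensorPow.instAddCommGroup (N : AdmissibleNorms E) (m : ℕ) :
    AddCommGroup (TensorPow N m) :=
  inferInstanceAs (AddCommGroup (⨂[ℝ]^m E))

instance TensorPow.instModule (N : AdmissibleNorms E) (m : ℕ) : Module ℝ (TensorPow N m) :=
  inferInstanceAs (Module ℝ (⨂[ℝ]^m E))

instance TensorPow.instNormedAddCommGroup (N : AdmissibleNorms E) (m : ℕ) :
    NormedAddCommGroup (TensorPow N m) :=
  AddGroupNorm.toNormedAddCommGroup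
    { toFun := fun a => N.nrm m a
      map_zero' := map_zero (N.nrm m)
      add_le' := map_add_le_add (N.nrm m)
      neg' := map_neg_eq_map (N.nrm m)
      eq_zero_of_map_eq_zero' := N.eq_zero m }

instance TensorPow.instNormedSpace (N : AdmissibleNorms E) (m : ℕ) :
    NormedSpace ℝ (TensorPow N m) where
  norm_smul_le c a := (map_smul_eq_mul (N.nrm m) c a).le

/-- The inclusion of `E^{⊗m}` into its completion. -/
def TensorPow.incl (N : AdmissibleNorms E) (m : ℕ) (a : ⨂[ℝ]^m E) :
    UniformSpace.Completion (TensorPow N m) :=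
  UniformSpace.Completion.coe' (α := TensorPow N m) a

theorem TensorPow.norm_incl (N : AdmissibleNorms E) (m : ℕ) (a : ⨂[ℝ]^m E) :
    ‖TensorPow.incl N m a‖ = N.nrm m a :=
  UniformSpace.Completion.norm_coe (E := TensorPow N m) a

/-- The completion of `⨁_m E^{⊗m}` in the norm `∑_m ‖t_m‖`, realised as the `ℓ¹`-sum of the
completions of the tensor powers `E^{⊗m}`. -/
abbrev TensorSeries (N : AdmissibleNorms E) : Type u :=
  lp (fun m => UniformSpace.Completion (TensorPow N m)) 1

/-- The tensor exponential `(v^{⊗m} / m!)_m`. -/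
def tensorExp (v : E) : (m : ℕ) → ⨂[ℝ]^m E :=
  fun m => ((m ! : ℝ)⁻¹) • PiTensorProduct.tprod ℝ (fun _ : Fin m => v)

/-- The unit `(1, 0, 0, …)` of the tensor convolution product. -/
def tensorOne : (m : ℕ) → ⨂[ℝ]^m E
  | 0 => TensorPower.algebraMap₀ 1
  | _ + 1 => 0

/-- The tensor convolution product `(s · t)_m = ∑_{i + j = m} s_i ⊗ t_j`. -/
def tensorConv (s t : (m : ℕ) → ⨂[ℝ]^m E) : (m : ℕ) → ⨂[ℝ]^m E :=
  fun m => ∑ p : {p : ℕ × ℕ // p ∈ Finset.HasAntidiagonal.antidiagonal m},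
    TensorPower.cast ℝ E (Finset.HasAntidiagonal.mem_antidiagonal.mp p.2)
      (TensorPower.mulEquiv (s p.1.1 ⊗ₜ[ℝ] t p.1.2))

end TensorAlgebra

/-! ## The signature -/

section Signature

variable {T : ℕ} {W : Type u} [NormedAddCommGroup W] [NormedSpace ℝ W]

/-- The space `ℝ ⊕ W`, with the norm `|s| + ‖w‖`. -/
abbrev TimeExt (W : Type u) [NormedAddCommGroup W] [NormedSpace ℝ W] : Type u :=
  WithLp 1 (ℝ × W)

/-- The time-augmented increments `Δ_0 x = (1, x(0))`, `Δ_t x = (1, x(t) - x(t-1))` for `t ≥ 1`. -/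
def increment (x : DPath T W) (t : Fin (T + 1)) : TimeExt W :=
  WithLp.toLp 1 ((1 : ℝ),
    Fin.cases (motive := fun _ => W) (x 0) (fun s : Fin T => x s.succ - x s.castSucc) t)

/-- The components of the signature `S(x) = exp(Δ_0 x) · exp(Δ_1 x) ⋯ exp(Δ_T x)`. -/
def sigComponents (x : DPath T W) : (m : ℕ) → ⨂[ℝ]^m (TimeExt W) :=
  (List.ofFn fun t : Fin (T + 1) => tensorExp (increment x t)).foldr tensorConv tensorOne

end Signature

section Summability

variable {E : Type u} [NormedAddCommGroup E] [NormedSpace ℝ E] (N : AdmissibleNorms E)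

theorem nrm_cast {m n : ℕ} (h : m = n) (a : ⨂[ℝ]^m E) :
    N.nrm n (TensorPower.cast ℝ E h a) = N.nrm m a := by
  subst h
  rw [TensorPower.cast_refl]
  rfl

theorem nrm_pow_le (v : E) (m : ℕ) :
    N.nrm m (PiTensorProduct.tprod ℝ fun _ : Fin m => v) ≤ ‖v‖ ^ m := by
  induction m with
  | zero =>
    have h : (PiTensorProduct.tprod ℝ fun _ : Fin 0 => v) =
        (TensorPower.algebraMap₀ 1 : ⨂[ℝ]^0 E) := by
      rw [TensorPower.algebraMap₀_one, TensorPower.gOne_def]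
      congr 1
      exact Subsingleton.elim _ _
    rw [h, N.nrm_zero]
    simp
  | succ m ih =>
    have h : (PiTensorProduct.tprod ℝ fun _ : Fin (m + 1) => v) =
        TensorPower.mulEquiv ((PiTensorProduct.tprod ℝ fun _ : Fin m => v) ⊗ₜ[ℝ]
          (PiTensorProduct.tprod ℝ fun _ : Fin 1 => v)) := by
      rw [← TensorPower.gMul_def, TensorPower.tprod_mul_tprod]
      congr 1
      ext i
      refine Fin.addCases (fun j => ?_) (fun j => ?_) i <;> simp
    rw [h, pow_succ]
    refine (N.nrm_mul_le _ _ _ _).trans ?_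
    rw [N.nrm_one]
    exact mul_le_mul_of_nonneg_right ih (norm_nonneg _)

theorem summable_tensorExp (v : E) : Summable fun m => N.nrm m (tensorExp v m) := by
  refine Summable.of_nonneg_of_le (fun m => apply_nonneg _ _) (fun m => ?_)
    (Real.summable_pow_div_factorial ‖v‖)
  rw [tensorExp, map_smul_eq_mul, Real.norm_of_nonneg (by positivity), div_eq_inv_mul]
  exact mul_le_mul_of_nonneg_left (nrm_pow_le N v m) (by positivity)

theorem summable_tensorOne : Summable fun m => N.nrm m (tensorOne m) := by
  refine summable_of_ne_finset_zero (s := {0}) fun m hm => ?_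
  cases m with
  | zero => simp at hm
  | succ m => exact map_zero _

theorem nrm_tensorConv_le (s t : (m : ℕ) → ⨂[ℝ]^m E) (m : ℕ) :
    N.nrm m (tensorConv s t m) ≤
      ∑ p ∈ Finset.HasAntidiagonal.antidiagonal m, N.nrm p.1 (s p.1) * N.nrm p.2 (t p.2) := by
  rw [← Finset.sum_coe_sort (Finset.HasAntidiagonal.antidiagonal m)
    (fun p => N.nrm p.1 (s p.1) * N.nrm p.2 (t p.2)), tensorConv]
  refine (Finset.le_sum_of_subadditive (N.nrm m) (map_zero _).le (map_add_le_add _) _ _).trans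
    (Finset.sum_le_sum fun p _ => ?_)
  rw [nrm_cast]
  exact N.nrm_mul_le _ _ _ _

theorem summable_antidiagonal_mul {f g : ℕ → ℝ} (hf : Summable f) (hg : Summable g)
    (hf0 : 0 ≤ f) (hg0 : 0 ≤ g) :
    Summable fun m => ∑ p ∈ Finset.HasAntidiagonal.antidiagonal m, f p.1 * g p.2 :=
  summable_sum_mul_antidiagonal_of_summable_mul (hf.mul_of_nonneg hg hf0 hg0)

theorem summable_tensorConv {s t : (m : ℕ) → ⨂[ℝ]^m E} (hs : Summable fun m => N.nrm m (s m))
    (ht : Summable fun m => N.nrm m (t m)) : Summable fun m => N.nrm m (tensorConv s t m) := by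
  have h := summable_antidiagonal_mul hs ht (fun m => apply_nonneg (N.nrm m) (s m))
    (fun m => apply_nonneg (N.nrm m) (t m))
  refine Summable.of_nonneg_of_le (fun m => ?_) (fun m => ?_) h
  · exact apply_nonneg (N.nrm m) (tensorConv s t m)
  · exact nrm_tensorConv_le N s t m

theorem tensorConv_zero (s t : (m : ℕ) → ⨂[ℝ]^m E) (hs : s 0 = TensorPower.algebraMap₀ 1)
    (ht : t 0 = TensorPower.algebraMap₀ 1) : tensorConv s t 0 = TensorPower.algebraMap₀ 1 := by
  have key : ∀ p : {p : ℕ × ℕ // p ∈ Finset.HasAntidiagonal.antidiagonal 0},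
      TensorPower.cast ℝ E (Finset.HasAntidiagonal.mem_antidiagonal.mp p.2)
        (TensorPower.mulEquiv (s p.1.1 ⊗ₜ[ℝ] t p.1.2)) =
      (TensorPower.algebraMap₀ 1 : ⨂[ℝ]^0 E) := by
    rintro ⟨⟨i, j⟩, hp⟩
    obtain ⟨rfl, rfl⟩ : i = 0 ∧ j = 0 := by simpa using hp
    change TensorPower.cast ℝ E _ (TensorPower.mulEquiv (s 0 ⊗ₜ[ℝ] t 0)) = _
    rw [hs, ht, ← TensorPower.gMul_def, TensorPower.algebraMap₀_mul_algebraMap₀, _root_.mul_one]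
  rw [tensorConv, Finset.sum_congr rfl fun p _ => key p, Finset.sum_const, Finset.card_univ,
    Fintype.card_coe]
  simp

theorem tensorExp_zero (v : E) : tensorExp v 0 = TensorPower.algebraMap₀ 1 := by
  rw [tensorExp, TensorPower.algebraMap₀_one, TensorPower.gOne_def]
  simp only [Nat.factorial_zero, Nat.cast_one, inv_one, one_smul]
  congr 1
  exact Subsingleton.elim _ _

end Summability

section RobustSignature

variable {T : ℕ} {W : Type u} [NormedAddCommGroup W] [NormedSpace ℝ W]

theorem sigComponents_zero (x : DPath T W) :
    sigComponents x 0 = TensorPower.algebraMap₀ 1 := by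
  have key : ∀ l : List ((m : ℕ) → ⨂[ℝ]^m (TimeExt W)),
      (∀ s ∈ l, s 0 = TensorPower.algebraMap₀ 1) →
        l.foldr tensorConv tensorOne 0 = TensorPower.algebraMap₀ 1 := by
    intro l
    induction l with
    | nil => intro _; rfl
    | cons s l ih =>
      intro h
      exact tensorConv_zero _ _ (h s (by simp)) (ih fun s' hs' => h s' (by simp [hs']))
  refine key _ fun s hs => ?_
  obtain ⟨t, rfl⟩ := List.mem_ofFn.mp hs
  exact tensorExp_zero _

theorem summable_sigComponents (N : AdmissibleNorms (TimeExt W)) (x : DPath T W) :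
    Summable fun m => N.nrm m (sigComponents x m) := by
  have key : ∀ l : List ((m : ℕ) → ⨂[ℝ]^m (TimeExt W)),
      (∀ s ∈ l, Summable fun m => N.nrm m (s m)) →
        Summable fun m => N.nrm m (l.foldr tensorConv tensorOne m) := by
    intro l
    induction l with
    | nil => intro _; exact summable_tensorOne N
    | cons s l ih =>
      intro h
      exact summable_tensorConv N (h s (by simp)) (ih fun s' hs' => h s' (by simp [hs']))
  refine key _ fun s hs => ?_
  obtain ⟨t, rfl⟩ := List.mem_ofFn.mp hs
  exact summable_tensorExp N _

/-- The elements `t` of the completed tensor algebra with `t_0 = 1`. -/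
def UnitTensorSeries {E : Type u} [NormedAddCommGroup E] [NormedSpace ℝ E]
    (N : AdmissibleNorms E) : Type u :=
  {t : TensorSeries N // (t : (m : ℕ) → UniformSpace.Completion (TensorPow N m)) 0 =
    TensorPow.incl N 0 (TensorPower.algebraMap₀ 1)}

instance UnitTensorSeries.instTopologicalSpace {E : Type u} [NormedAddCommGroup E]
    [NormedSpace ℝ E] (N : AdmissibleNorms E) : TopologicalSpace (UnitTensorSeries N) :=
  inferInstanceAs (TopologicalSpace
    {t : TensorSeries N // (t : (m : ℕ) → UniformSpace.Completion (TensorPow N m)) 0 =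
      TensorPow.incl N 0 (TensorPower.algebraMap₀ 1)})

/-- The signature map `S : (I → W) → T¹(W)`, where `T¹(W)` is the completed tensor algebra over
`ℝ ⊕ W`. -/
def signature (N : AdmissibleNorms (TimeExt W)) (x : DPath T W) : UnitTensorSeries N :=
  ⟨⟨fun m => TensorPow.incl N m (sigComponents x m), by
    refine memℓp_gen ?_
    simp only [ENNReal.toReal_one, Real.rpow_one, TensorPow.norm_incl]
    exact summable_sigComponents N x⟩,
    congrArg (TensorPow.incl N 0) (sigComponents_zero x)⟩

/-- A tensor normalization: a continuous, injective, bounded map `Λ` of the form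
`t ↦ δ_{λ(t)} t = (λ(t)^m t_m)_m` with `λ(t) > 0`, on the tensor series `t` with `t_0 = 1`. -/
structure TensorNormalization {E : Type u} [NormedAddCommGroup E] [NormedSpace ℝ E]
    (N : AdmissibleNorms E) where
  /-- the dilation factor `λ` -/
  scale : UnitTensorSeries N → ℝ
  scale_pos : ∀ t, 0 < scale t
  /-- the map `Λ` -/
  toFun : UnitTensorSeries N → TensorSeries N
  toFun_apply : ∀ (t : UnitTensorSeries N) (m : ℕ),
    (toFun t : (m : ℕ) → UniformSpace.Completion (TensorPow N m)) m = scale t ^ m • t.1 m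
  continuous_toFun : Continuous toFun
  injective_toFun : Function.Injective toFun
  bounded_toFun : ∃ R : ℝ, ∀ t, ‖toFun t‖ ≤ R

end RobustSignature

/-! ## Higher rank expected signatures -/

/-- A real Banach space, bundled. -/
structure BanachSp : Type (u + 1) where
  /-- the underlying type -/
  carrier : Type u
  normedAddCommGroup : NormedAddCommGroup carrier
  normedSpace : NormedSpace ℝ carrier
  completeSpace : CompleteSpace carrier

instance BanachSp.instCoeSort : CoeSort BanachSp.{u} (Type u) := ⟨BanachSp.carrier⟩

attribute [instance] BanachSp.normedAddCommGroup BanachSp.normedSpace BanachSp.completeSpace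

/-- The choices that enter the robust signature map on paths in `W`: admissible norms on the tensor
powers of `ℝ ⊕ W`, and a tensor normalization. -/
structure SignatureScheme (W : Type u) [NormedAddCommGroup W] [NormedSpace ℝ W] where
  norms : AdmissibleNorms (TimeExt W)
  normalization : TensorNormalization norms

/-- The robust signature map `Λ ∘ S`. -/
def robustSignature {T : ℕ} {W : Type u} [NormedAddCommGroup W] [NormedSpace ℝ W]
    (c : SignatureScheme W) (x : DPath T W) : TensorSeries c.norms :=
  c.normalization.toFun (signature c.norms x)

section HigherRank

variable (c : ℕ → (W : BanachSp.{u}) → SignatureScheme W)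
variable (T : ℕ) (V : Type u) [NormedAddCommGroup V] [NormedSpace ℝ V] [CompleteSpace V]

/-- The Banach spaces `T^0(V) = V`, `T^{r+1}(V) = T¹(T^r(V))`, the norms on the tensor powers of
`ℝ ⊕ T^r(V)` being those of the scheme `c r`. Only the values of `c` on the spaces of this tower
matter. -/
def rankTensor : ℕ → BanachSp.{u}
  | 0 => ⟨V, inferInstance, inferInstance, inferInstance⟩
  | r + 1 => ⟨TensorSeries (c r (rankTensor r)).norms, inferInstance, inferInstance, inferInstance⟩

/-- The robust expected signature map of rank `r` on `Prob_r(V)`: the identity of `V` for `r = 0`,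
and `μ ↦ ∫ ΛS(t ↦ S̄_r(x(t))) μ(dx)`, a Bochner integral in `T^{r+1}(V)`, at rank `r + 1`. -/
def expectedSignature : (r : ℕ) → rankProb T V r → rankTensor c V r
  | 0 => fun v => v
  | r + 1 => fun (μ : ProbabilityMeasure (DPath T (rankProb T V r))) =>
    (∫ x : DPath T (rankProb T V r), robustSignature (c r (rankTensor c V r))
        (fun t : Fin (T + 1) => expectedSignature r (x t) : DPath T (rankTensor c V r))
      ∂(μ : Measure (DPath T (rankProb T V r))) :
      TensorSeries (c r (rankTensor c V r)).norms)

variable {T V}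
variable [SecondCountableTopology V]

/-- `Φ_r(X) = S̄_{r+1}(Law(X̂^r))`. -/
def adaptedFeature (r : ℕ) (A : AdaptedProcess.{u, w} T V) : rankTensor c V (r + 1) :=
  expectedSignature c T V (r + 1) (A.predictionLaw r)

/-- The rank `r` adapted signature distance `d_r(X, Y) = ‖Φ_r(X) - Φ_r(Y)‖`. -/
def adaptedSigDist (r : ℕ) (A B : AdaptedProcess.{u, w} T V) : ℝ :=
  ‖adaptedFeature c r A - adaptedFeature c r B‖

end HigherRank

end

/-!
The law of a prediction process determines `d_r` through the robust expected signature
`S̄_{r+1} : Prob_{r+1}(V) → T^{r+1}(V)`, so everything rests on `S̄_k` being continuous and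
injective for every `k`, which follows by induction on `k`. A continuous injective map into a
Hausdorff space is an embedding on each compact set, and this is the second part.

Continuity: on paths, the components of the signature are continuous and locally dominated by a
summable sequence, so the signature is norm-continuous; the Bochner integral of a bounded continuous
map depends continuously on the measure because a partition of unity approximates the map by
combinations of finitely many vectors.

Injectivity: by the shuffle identity, which survives the dilation by `λ^m` since all shuffles of two
words have the same length, the coordinates of the robust signature along words of functionals span
an algebra of bounded continuous functions. It separates paths: the word consisting of the time
functional `τ` recovers the scale `λ`, and the words `τ ⋯ τ l` then recover `l` of every increment.
As `Prob_k(V)` is Polish, the integrals of these functions determine the measure.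
-/

noncomputable section

section PolishSpaceOfProbabilityMeasures

open scoped NNReal ENNReal

theorem isOpen_setOf_lt_probabilityMeasure {X : Type*} [TopologicalSpace X]
    [HasOuterApproxClosed X] [MeasurableSpace X] [OpensMeasurableSpace X] {U : Set X}
    (hU : IsOpen U) (q : ℝ≥0) : IsOpen {μ : ProbabilityMeasure X | q < μ U} := by
  refine isOpen_iff_mem_nhds.2 fun μ hμ => ?_
  have h_liminf : (q : ℝ≥0∞) < (𝓝 μ).liminf fun ν : ProbabilityMeasure X => (ν : Measure X) U :=
    lt_of_lt_of_le
      (by rw [← ProbabilityMeasure.ennreal_coeFn_eq_coeFn_toMeasure]; exact_mod_cast hμ)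
      (ProbabilityMeasure.le_liminf_measure_open_of_tendsto tendsto_id hU)
  filter_upwards [eventually_lt_of_lt_liminf h_liminf] with ν hν
  rw [← ProbabilityMeasure.ennreal_coeFn_eq_coeFn_toMeasure] at hν
  exact_mod_cast hν

/-- The sets `{μ | q < μ U}`, for `U` a finite union of sets of `b` and `q ∈ D`; a subbasis of the
weak topology if `b` is a basis and `D` is dense. -/
def weakSubbasis {X : Type*} [MeasurableSpace X] (b : Set (Set X)) (D : Set ℝ≥0) :
    Set (Set (ProbabilityMeasure X)) :=
  (fun p : Finset (Set X) × ℝ≥0 => {μ : ProbabilityMeasure X | p.2 < μ (⋃ t ∈ p.1, t)}) ''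
    ({s : Finset (Set X) | (s : Set (Set X)) ⊆ b} ×ˢ D)

theorem countable_weakSubbasis {X : Type*} [MeasurableSpace X] {b : Set (Set X)} {D : Set ℝ≥0}
    (hb : b.Countable) (hD : D.Countable) : (weakSubbasis b D).Countable := by
  have h_finsets : {s : Finset (Set X) | (s : Set (Set X)) ⊆ b}.Countable :=
    ((Set.countable_ofPred_finite_subset hb).preimage Finset.coe_injective).mono
      fun s hs => show _ ∧ _ from ⟨s.finite_toSet, hs⟩
  exact (h_finsets.prod hD).image _

theorem generateFrom_weakSubbasis {X : Type*} [TopologicalSpace X]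
    [HasOuterApproxClosed X] [MeasurableSpace X] [OpensMeasurableSpace X] {b : Set (Set X)}
    (hb : TopologicalSpace.IsTopologicalBasis b) (hbc : b.Countable) {D : Set ℝ≥0}
    (hD : Dense D) (hDc : D.Countable) :
    (inferInstance : TopologicalSpace (ProbabilityMeasure X)) =
      .generateFrom (weakSubbasis b D) := by
  set τ := TopologicalSpace.generateFrom (weakSubbasis (X := X) b D)
  refine le_antisymm (le_generateFrom ?_) ((le_iff_nhds τ _).2 fun μ => ?_)
  · rintro _ ⟨⟨s, q⟩, ⟨hs, -⟩, rfl⟩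
    exact isOpen_setOf_lt_probabilityMeasure (isOpen_biUnion fun t ht => hb.isOpen (hs ht)) q
  have := hb.secondCountableTopology hbc
  have : @SecondCountableTopology _ τ := ⟨_, countable_weakSubbasis hbc hDc, rfl⟩
  refine tendsto_of_forall_isOpen_le_liminf (μs := fun ν => ν) (L := @nhds _ τ μ) fun G hG => ?_
  refine (le_liminf_iff (isCoboundedUnder_ge_of_le (x := 1) _ (by simp))
    (by isBoundedDefault)).2 fun p hp => ?_
  obtain ⟨s, hsb, hps, hsG⟩ := μ.exists_lt_measure_biUnion_of_isOpen (S := b)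
    (fun u hu x hx => by
      obtain ⟨t, ht, hxt, htu⟩ := hb.exists_subset_of_mem_open hx hu
      exact ⟨t, ht, (hb.isOpen ht).mem_nhds hxt, htu⟩) hG hp
  obtain ⟨q, hqD, hpq, hqs⟩ := hD.exists_between hps
  have h_open : IsOpen[τ] {ν : ProbabilityMeasure X | q < ν (⋃ t ∈ s, t)} :=
    TopologicalSpace.isOpen_generateFrom_of_mem ⟨(s, q), ⟨hsb, hqD⟩, rfl⟩
  filter_upwards [@IsOpen.mem_nhds _ τ μ _ h_open hqs] with ν hν
  exact hpq.trans (hν.trans_le (ν.apply_mono hsG))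

instance instSecondCountableTopologyProbabilityMeasure {X : Type*} [TopologicalSpace X]
    [SecondCountableTopology X] [HasOuterApproxClosed X] [MeasurableSpace X]
    [OpensMeasurableSpace X] : SecondCountableTopology (ProbabilityMeasure X) := by
  obtain ⟨b, hbc, -, hb⟩ := TopologicalSpace.exists_countable_basis X
  obtain ⟨D, hDc, hD⟩ := TopologicalSpace.exists_countable_dense ℝ≥0
  exact ⟨_, countable_weakSubbasis hbc hDc, generateFrom_weakSubbasis hb hbc hD hDc⟩

theorem isCompact_iInter_cthickening {ι X : Type*} [PseudoMetricSpace X] [CompleteSpace X]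
    {l : Filter ι} [l.NeBot] {K : ι → Set X} (hK : ∀ i, IsCompact (K i)) {δ : ι → ℝ}
    (hδ : Tendsto δ l (𝓝 0)) : IsCompact (⋂ i, Metric.cthickening (δ i) (K i)) := by
  refine TotallyBounded.isCompact_of_isClosed (Metric.totallyBounded_iff.2 fun ε hε => ?_)
    (isClosed_iInter fun i => Metric.isClosed_cthickening)
  obtain ⟨i, hi⟩ := ((tendsto_order.1 hδ).2 (ε / 2) (half_pos hε)).exists
  obtain ⟨t, ht, hKt⟩ := Metric.totallyBounded_iff.1 (hK i).totallyBounded (ε / 2) (half_pos hε)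
  refine ⟨t, ht, fun x hx => ?_⟩
  obtain ⟨y, hyK, hxy⟩ := Metric.mem_thickening_iff.1 <|
    Metric.cthickening_subset_thickening' (half_pos hε) hi _ (Set.mem_iInter.1 hx i)
  obtain ⟨z, hz, hyz⟩ := Set.mem_iUnion₂.1 (hKt hyK)
  refine Set.mem_iUnion₂.2 ⟨z, hz, ?_⟩
  calc dist x z ≤ dist x y + dist y z := dist_triangle x y z
    _ < ε / 2 + ε / 2 := add_lt_add hxy hyz
    _ = ε := add_halves ε

theorem isTightMeasureSet_of_forall_exists_cthickening {X : Type*} [PseudoMetricSpace X]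
    [CompleteSpace X] [MeasurableSpace X] {S : Set (Measure X)}
    (hS : ∀ δ : ℝ≥0, 0 < δ → ∃ K : Set X, IsCompact K ∧
      ∀ μ ∈ S, μ (Metric.cthickening δ K)ᶜ ≤ δ) : IsTightMeasureSet S := by
  refine isTightMeasureSet_iff_exists_isCompact_measure_compl_le.2 fun ε hε => ?_
  obtain ⟨δ, hδ, hδε⟩ := ENNReal.exists_pos_sum_of_countable hε.ne' ℕ
  have hδ0 : Tendsto (fun n => (δ n : ℝ)) atTop (𝓝 0) := by
    rw [← NNReal.coe_zero, NNReal.tendsto_coe]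
    exact NNReal.tendsto_atTop_zero_of_summable
      (ENNReal.tsum_coe_ne_top_iff_summable.1 hδε.ne_top)
  choose K hK hKδ using fun n => hS (δ n) (hδ n)
  refine ⟨⋂ n, Metric.cthickening (δ n) (K n), isCompact_iInter_cthickening hK hδ0,
    fun μ hμ => ?_⟩
  calc μ (⋂ n, Metric.cthickening (δ n) (K n))ᶜ
      ≤ ∑' n, μ (Metric.cthickening (δ n) (K n))ᶜ := by
        rw [Set.compl_iInter]
        exact measure_iUnion_le _
    _ ≤ ∑' n, (δ n : ℝ≥0∞) := ENNReal.tsum_le_tsum fun n => hKδ n μ hμ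
    _ ≤ ε := hδε.le

theorem isTightMeasureSet_of_totallyBounded {X : Type*} [PseudoMetricSpace X] [CompleteSpace X]
    [SecondCountableTopology X] [MeasurableSpace X] [BorelSpace X]
    {S : Set (LevyProkhorov (ProbabilityMeasure X))} (hS : TotallyBounded S) :
    IsTightMeasureSet ((fun μ => (μ.toMeasure : Measure X)) '' S) := by
  refine isTightMeasureSet_of_forall_exists_cthickening fun δ hδ => ?_
  obtain ⟨t, ht, hSt⟩ := EMetric.totallyBounded_iff.1 hS (δ / 2 : ℝ≥0) (by positivity)
  have h_tight := isTightMeasureSet_of_isCompact_closure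
    (ht.image LevyProkhorov.toMeasure).isCompact.closure
  obtain ⟨K, hK, hKt⟩ := isTightMeasureSet_iff_exists_isCompact_measure_compl_le.1 h_tight
    (δ / 2 : ℝ≥0) (by positivity)
  refine ⟨K, hK, ?_⟩
  rintro _ ⟨μ, hμ, rfl⟩
  obtain ⟨ν, hν, hμν⟩ := Set.mem_iUnion₂.1 (hSt hμ)
  have h_subset : Metric.thickening (δ / 2 : ℝ≥0) (Metric.cthickening δ K)ᶜ ⊆ Kᶜ := by
    intro x hx hxK
    obtain ⟨y, hy, hxy⟩ := Metric.mem_thickening_iff.1 hx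
    refine hy (Metric.mem_cthickening_of_dist_le y x δ K hxK ?_)
    rw [dist_comm]
    exact hxy.le.trans (NNReal.coe_le_coe.2 (half_le_self hδ.le))
  calc (μ.toMeasure : Measure X) (Metric.cthickening δ K)ᶜ
      ≤ (ν.toMeasure : Measure X) (Metric.thickening (δ / 2 : ℝ≥0) (Metric.cthickening δ K)ᶜ)
          + (δ / 2 : ℝ≥0) :=
        left_measure_le_of_levyProkhorovEDist_lt hμν Metric.isClosed_cthickening.measurableSet.compl
    _ ≤ (δ / 2 : ℝ≥0) + (δ / 2 : ℝ≥0) := by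
        gcongr
        exact (measure_mono h_subset).trans (hKt _ ⟨_, ⟨ν, hν, rfl⟩, rfl⟩)
    _ = δ := by rw [← ENNReal.coe_add, add_halves]

instance instCompleteSpaceLevyProkhorov {X : Type*} [MetricSpace X] [CompleteSpace X]
    [SecondCountableTopology X] [MeasurableSpace X] [BorelSpace X] :
    CompleteSpace (LevyProkhorov (ProbabilityMeasure X)) := by
  refine Metric.complete_of_cauchySeq_tendsto fun u hu => ?_
  have h_tight := isTightMeasureSet_of_totallyBounded hu.totallyBounded_range
  let e := LevyProkhorov.probabilityMeasureHomeomorph (Ω := X)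
  have h_compact : IsCompact (closure (e.symm '' Set.range u)) :=
    isCompact_closure_of_isTightMeasureSet <| h_tight.subset <| by
      rintro _ ⟨_, ⟨ν, hν, rfl⟩, rfl⟩
      exact ⟨ν, hν, rfl⟩
  obtain ⟨μ, -, hμ⟩ := cauchySeq_tendsto_of_isComplete (h_compact.image e.continuous).isComplete
    (fun n => ⟨e.symm (u n), subset_closure ⟨_, ⟨n, rfl⟩, rfl⟩, rfl⟩) hu
  exact ⟨μ, hμ⟩

instance instPolishSpaceProbabilityMeasure {X : Type*} [TopologicalSpace X] [PolishSpace X]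
    [MeasurableSpace X] [BorelSpace X] : PolishSpace (ProbabilityMeasure X) := by
  let := TopologicalSpace.upgradeIsCompletelyMetrizable X
  let e := LevyProkhorov.probabilityMeasureHomeomorph (Ω := X)
  have := e.isClosedEmbedding.IsCompletelyMetrizableSpace
  exact { }

end PolishSpaceOfProbabilityMeasures

section BochnerIntegral

open scoped BoundedContinuousFunction

variable {X B : Type*} [TopologicalSpace X]

theorem exists_partition_dist_lt [TopologicalSpace.PseudoMetrizableSpace X]
    [TopologicalSpace.SeparableSpace X] [Nonempty X] [PseudoMetricSpace B] {F : X → B}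
    (hF : Continuous F) {ε : ℝ} (hε : 0 < ε) :
    ∃ (y : ℕ → X) (θ : ℕ → X →ᵇ ℝ), (∀ i x, 0 ≤ θ i x) ∧
      (∀ n x, ∑ i ∈ Finset.range n, θ i x ≤ 1) ∧
      (∀ x, ∀ᶠ n in atTop, ∑ i ∈ Finset.range n, θ i x = 1) ∧
      ∀ i x, θ i x ≠ 0 → dist (F x) (F (y i)) < ε := by
  let := TopologicalSpace.pseudoMetrizableSpacePseudoMetric X
  let y := TopologicalSpace.denseSeq X
  have h_open (z : X) : IsOpen {x | dist (F x) (F z) < ε} :=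
    isOpen_lt (hF.dist continuous_const) continuous_const
  obtain ⟨ρ, hρ⟩ := PartitionOfUnity.exists_isSubordinate isClosed_univ
    (fun i => {x | dist (F x) (F (y i)) < ε}) (fun i => h_open (y i)) fun x _ => by
      obtain ⟨i, hi⟩ := (TopologicalSpace.denseRange_denseSeq X).exists_mem_open (h_open x)
        ⟨x, by simpa using hε⟩
      exact Set.mem_iUnion.2 ⟨i, by simpa [dist_comm] using hi⟩
  refine ⟨y, fun i => .ofNormedAddCommGroup (ρ i) (ρ i).continuous 1 fun x => ?_, ρ.nonneg,
    fun n x => ?_, fun x => ?_, fun i x hx => hρ i (subset_tsupport _ hx)⟩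
  · rw [Real.norm_of_nonneg (ρ.nonneg i x)]
    exact ρ.le_one i x
  · calc ∑ i ∈ Finset.range n, ρ i x
        ≤ ∑ i ∈ Finset.range n ∪ ρ.finsupport x, ρ i x :=
          Finset.sum_le_sum_of_subset_of_nonneg Finset.subset_union_left fun i _ _ => ρ.nonneg i x
      _ = 1 := ρ.sum_finsupport' (Set.mem_univ x) Finset.subset_union_right
  · filter_upwards [Filter.tendsto_finset_range.eventually_ge_atTop (ρ.finsupport x)] with n hn
    exact ρ.sum_finsupport' (Set.mem_univ x) hn

theorem norm_sub_sum_smul_le [NormedAddCommGroup B] [NormedSpace ℝ B] {ι : Type*} {s : Finset ι}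
    {θ : ι → ℝ} (hθ : ∀ i ∈ s, 0 ≤ θ i) (hθs : ∑ i ∈ s, θ i ≤ 1) {b : B} {y : ι → B} {ε : ℝ}
    (hε : 0 ≤ ε) (hy : ∀ i ∈ s, θ i ≠ 0 → ‖b - y i‖ ≤ ε) :
    ‖b - ∑ i ∈ s, θ i • y i‖ ≤ ε + (1 - ∑ i ∈ s, θ i) * ‖b‖ := by
  have h_split : b - ∑ i ∈ s, θ i • y i =
      ∑ i ∈ s, θ i • (b - y i) + (1 - ∑ i ∈ s, θ i) • b := by
    simp only [smul_sub, Finset.sum_sub_distrib, ← Finset.sum_smul, sub_smul, one_smul]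
    abel
  have h_near : ∀ i ∈ s, ‖θ i • (b - y i)‖ ≤ θ i * ε := fun i hi => by
    rw [norm_smul, Real.norm_of_nonneg (hθ i hi)]
    by_cases h0 : θ i = 0
    · simp [h0]
    · exact mul_le_mul_of_nonneg_left (hy i hi h0) (hθ i hi)
  rw [h_split]
  refine norm_add_le_of_le ?_ ?_
  · calc ‖∑ i ∈ s, θ i • (b - y i)‖ ≤ ∑ i ∈ s, θ i * ε := norm_sum_le_of_le s h_near
      _ = (∑ i ∈ s, θ i) * ε := (Finset.sum_mul ..).symm
      _ ≤ ε := mul_le_of_le_one_left hε hθs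
  · rw [norm_smul, Real.norm_of_nonneg (sub_nonneg.2 hθs)]

variable [MeasurableSpace X] [OpensMeasurableSpace X]

theorem tendsto_integral_of_norm_le_one {μ : Measure X} [IsFiniteMeasure μ] {h : ℕ → X →ᵇ ℝ}
    (h_le : ∀ n x, ‖h n x‖ ≤ 1) (h_lim : ∀ x, Tendsto (fun n => h n x) atTop (𝓝 0)) :
    Tendsto (fun n => ∫ x, h n x ∂μ) atTop (𝓝 0) := by
  rw [← integral_zero X ℝ (μ := μ)]
  exact tendsto_integral_of_dominated_convergence (fun _ => 1)
    (fun n => (h n).continuous.measurable.aestronglyMeasurable) (integrable_const _)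
    (fun n => ae_of_all _ (h_le n)) (ae_of_all _ h_lim)

theorem integrable_boundedContinuousFunction [SecondCountableTopology X] [NormedAddCommGroup B]
    (F : X →ᵇ B) (μ : Measure X) [IsFiniteMeasure μ] : Integrable F μ :=
  .of_bound F.continuous.stronglyMeasurable.aestronglyMeasurable ‖F‖
    (ae_of_all _ F.norm_coe_le_norm)

variable [NormedAddCommGroup B] [NormedSpace ℝ B] [CompleteSpace B]

theorem norm_integral_sub_sum_smul_le [SecondCountableTopology X] (μ : ProbabilityMeasure X)
    (F : X →ᵇ B) {s : Finset ℕ} {θ : ℕ → X →ᵇ ℝ} (hθ : ∀ i x, 0 ≤ θ i x)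
    (hθs : ∀ x, ∑ i ∈ s, θ i x ≤ 1) {y : ℕ → B} {ε : ℝ} (hε : 0 ≤ ε)
    (hy : ∀ i x, θ i x ≠ 0 → ‖F x - y i‖ ≤ ε) :
    ‖∫ x, F x ∂(μ : Measure X) - ∑ i ∈ s, (∫ x, θ i x ∂(μ : Measure X)) • y i‖ ≤
      ε + (∫ x, (1 - ∑ i ∈ s, θ i) x ∂(μ : Measure X)) * ‖F‖ := by
  have hF := integrable_boundedContinuousFunction F (μ : Measure X)
  have hθy (i : ℕ) : Integrable (fun x => θ i x • y i) (μ : Measure X) :=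
    ((θ i).integrable _).smul_const _
  have h_tail : Integrable (fun x => (1 - ∑ i ∈ s, θ i) x * ‖F‖) (μ : Measure X) :=
    ((1 - ∑ i ∈ s, θ i).integrable _).mul_const _
  calc ‖∫ x, F x ∂(μ : Measure X) - ∑ i ∈ s, (∫ x, θ i x ∂(μ : Measure X)) • y i‖
      = ‖∫ x, (F x - ∑ i ∈ s, θ i x • y i) ∂(μ : Measure X)‖ := by
        rw [integral_sub hF (integrable_finsetSum s fun i _ => hθy i),
          integral_finsetSum s fun i _ => hθy i]
        simp only [integral_smul_const]
    _ ≤ ∫ x, (ε + (1 - ∑ i ∈ s, θ i) x * ‖F‖) ∂(μ : Measure X) :=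
        norm_integral_le_of_norm_le ((integrable_const ε).add h_tail) <| ae_of_all _ fun x => by
          refine (norm_sub_sum_smul_le (fun i _ => hθ i x) (hθs x) hε fun i _ => hy i x).trans ?_
          simp only [BoundedContinuousFunction.sub_apply, BoundedContinuousFunction.coe_one,
            Pi.one_apply, BoundedContinuousFunction.sum_apply]
          have := sub_nonneg.2 (hθs x)
          gcongr
          exact F.norm_coe_le_norm x
    _ = ε + (∫ x, (1 - ∑ i ∈ s, θ i) x ∂(μ : Measure X)) * ‖F‖ := by
        rw [integral_add (integrable_const ε) h_tail, integral_mul_const]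
        simp

theorem continuous_integral_probabilityMeasure [TopologicalSpace.PseudoMetrizableSpace X]
    [SecondCountableTopology X] (F : X →ᵇ B) :
    Continuous fun μ : ProbabilityMeasure X => ∫ x, F x ∂(μ : Measure X) := by
  have h_cont (f : X →ᵇ ℝ) : Continuous fun μ : ProbabilityMeasure X => ∫ x, f x ∂(μ : Measure X) :=
    ProbabilityMeasure.continuous_integral_boundedContinuousFunction f
  refine continuous_of_locally_uniform_approx_of_continuousAt fun μ u hu => ?_
  obtain ⟨δ, hδ, hδu⟩ := Metric.mem_uniformity_dist.1 hu
  have := μ.nonempty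
  obtain ⟨y, θ, hθ, hθ1, hθlim, hy⟩ := exists_partition_dist_lt F.continuous (half_pos hδ)
  have h_tail : Tendsto (fun n => (∫ x, (1 - ∑ i ∈ Finset.range n, θ i) x ∂(μ : Measure X)) * ‖F‖)
      atTop (𝓝 (0 * ‖F‖)) := by
    refine (tendsto_integral_of_norm_le_one (fun n x => ?_) fun x => ?_).mul_const _
    · have := Finset.sum_nonneg fun i (_ : i ∈ Finset.range n) => hθ i x
      have := hθ1 n x
      simpa [abs_le] using ⟨by linarith, by linarith⟩
    · refine tendsto_const_nhds.congr' ?_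
      filter_upwards [hθlim x] with n hn
      simp [hn]
  rw [zero_mul] at h_tail
  obtain ⟨n, hn⟩ := ((tendsto_order.1 h_tail).2 (δ / 2) (half_pos hδ)).exists
  refine ⟨_, ((h_cont _).mul continuous_const).continuousAt.eventually_lt continuousAt_const hn,
    fun ν => ∑ i ∈ Finset.range n, (∫ x, θ i x ∂(ν : Measure X)) • F (y i),
    (continuous_finsetSum _ fun i _ => (h_cont (θ i)).smul continuous_const).continuousAt,
    fun ν hν => hδu ?_⟩
  rw [dist_eq_norm]
  calc _ ≤ δ / 2 + (∫ x, (1 - ∑ i ∈ Finset.range n, θ i) x ∂(ν : Measure X)) * ‖F‖ :=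
        norm_integral_sub_sum_smul_le ν F hθ (hθ1 n) (half_pos hδ).le fun i x hx => by
          rw [← dist_eq_norm]
          exact (hy i x hx).le
    _ < δ / 2 + δ / 2 := by gcongr; exact hν
    _ = δ := add_halves δ

end BochnerIntegral

section MeasureDetermining

open scoped BoundedContinuousFunction

theorem eq_of_forall_integral_eq_of_span_mul_mem {X ι : Type*} [TopologicalSpace X] [PolishSpace X]
    [MeasurableSpace X] [BorelSpace X] {F : ι → X →ᵇ ℝ}
    (h_one : 1 ∈ Submodule.span ℝ (Set.range F))
    (h_mul : ∀ i j, F i * F j ∈ Submodule.span ℝ (Set.range F))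
    (h_sep : ∀ x y, (∀ i, F i x = F i y) → x = y) {μ ν : Measure X} [IsFiniteMeasure μ]
    [IsFiniteMeasure ν] (h : ∀ i, ∫ x, F i x ∂μ = ∫ x, F i x ∂ν) : μ = ν := by
  have h_span : ∀ f ∈ Submodule.span ℝ (Set.range F), ∫ x, f x ∂μ = ∫ x, f x ∂ν := fun f hf => by
    induction hf using Submodule.span_induction with
    | mem f h_mem =>
      obtain ⟨i, rfl⟩ := h_mem
      exact h i
    | zero => simp
    | add f g _ _ h_f h_g =>
      simpa only [BoundedContinuousFunction.add_apply,
        integral_add (f.integrable _) (g.integrable _)] using congr($h_f + $h_g)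
    | smul a f _ h_f =>
      simpa only [BoundedContinuousFunction.smul_apply, integral_smul] using congr(a • $h_f)
  let A : Subalgebra ℝ (X →ᵇ ℝ) := (Submodule.span ℝ (Set.range F)).toSubalgebra h_one
    fun f g hf hg => by
      refine (Submodule.mul_le (P := Submodule.span ℝ (Set.range F))).1 ?_ f hf g hg
      rw [Submodule.span_mul_span, Submodule.span_le]
      rintro _ ⟨_, ⟨i, rfl⟩, _, ⟨j, rfl⟩, rfl⟩
      exact h_mul i j
  let A' : StarSubalgebra ℝ (X →ᵇ ℝ) := ⟨A, fun {f} hf => by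
    rwa [show star f = f from BoundedContinuousFunction.ext fun x => star_trivial (f x)]⟩
  refine ext_of_forall_mem_subalgebra_integral_eq_of_polish (𝕜 := ℝ) (A := A')
    (fun x y hxy => ?_) h_span
  obtain ⟨i, hi⟩ := not_forall.1 fun h_eq => hxy (h_sep x y h_eq)
  exact ⟨F i, ⟨_, ⟨F i, Submodule.subset_span ⟨i, rfl⟩, rfl⟩, rfl⟩, hi⟩

end MeasureDetermining

section Sequences

theorem tendsto_of_continuous_injective_of_isCompact {X Y ι : Type*} [TopologicalSpace X]
    [TopologicalSpace Y] [T2Space Y] {l : Filter ι} {f : X → Y} (hf : Continuous f)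
    (h_inj : Function.Injective f) {K : Set X} (hK : IsCompact K) {u : ι → X} (hu : ∀ i, u i ∈ K)
    {a : X} (h : Tendsto (f ∘ u) l (𝓝 (f a))) : Tendsto u l (𝓝 a) := by
  refine hK.tendsto_nhds_of_unique_mapClusterPt (Eventually.of_forall hu) fun b _ hb => h_inj ?_
  have h_clus : MapClusterPt (f b) l (f ∘ u) := hb.continuousAt_comp hf.continuousAt
  exact eq_of_nhds_neBot (h_clus.neBot.mono (inf_le_inf_left _ h))

end Sequences

section PathSpaces

instance DPath.instPolishSpace (T : ℕ) (Y : Type u) [TopologicalSpace Y] [PolishSpace Y] :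
    PolishSpace (DPath T Y) :=
  inferInstanceAs (PolishSpace (Fin (T + 1) → Y))

instance rankProb.instPolishSpace (T : ℕ) (V : Type u) [TopologicalSpace V] [PolishSpace V] :
    (r : ℕ) → PolishSpace (rankProb T V r)
  | 0 => inferInstanceAs (PolishSpace V)
  | r + 1 =>
    have := rankProb.instPolishSpace T V r
    inferInstanceAs (PolishSpace (ProbabilityMeasure (DPath T (rankProb T V r))))

end PathSpaces

section ExpProduct

variable {E : Type u} [NormedAddCommGroup E] [NormedSpace ℝ E] {n : ℕ}

/-- The product `exp(v 0) · exp(v 1) ⋯ exp(v (n - 1))` of tensor exponentials. The signature of a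
path `x` is the case `v = increment x`. -/
def expProduct (v : Fin n → E) : (m : ℕ) → ⨂[ℝ]^m E :=
  (List.ofFn fun t => tensorExp (v t)).foldr tensorConv tensorOne

theorem expProduct_zero (v : Fin 0 → E) : expProduct v = tensorOne :=
  rfl

theorem expProduct_succ (v : Fin (n + 1) → E) :
    expProduct v = tensorConv (tensorExp (v 0)) (expProduct fun t => v t.succ) := by
  rw [expProduct, List.ofFn_succ, List.foldr_cons, expProduct]

end ExpProduct

section SignatureContinuity

variable {E : Type u} [NormedAddCommGroup E] [NormedSpace ℝ E] (N : AdmissibleNorms E)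

theorem nrm_tprod_le {m : ℕ} (v : Fin m → E) :
    N.nrm m (PiTensorProduct.tprod ℝ v) ≤ ∏ i, ‖v i‖ := by
  induction m with
  | zero => simpa [Subsingleton.elim v fun _ => 0] using nrm_pow_le N (0 : E) 0
  | succ m ih =>
    have h_split : PiTensorProduct.tprod ℝ v =
        TensorPower.mulEquiv ((PiTensorProduct.tprod ℝ fun i : Fin m => v i.castSucc) ⊗ₜ[ℝ]
          (PiTensorProduct.tprod ℝ fun _ : Fin 1 => v (Fin.last m))) := by
      rw [← TensorPower.gMul_def, TensorPower.tprod_mul_tprod]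
      congr 1
      ext i
      refine Fin.lastCases ?_ (fun j => ?_) i
      · exact (Fin.append_right _ (fun _ : Fin 1 => v (Fin.last m)) 0).symm
      · exact (Fin.append_left (fun i : Fin m => v i.castSucc) _ j).symm
    calc N.nrm (m + 1) (PiTensorProduct.tprod ℝ v)
        ≤ N.nrm m (PiTensorProduct.tprod ℝ fun i : Fin m => v i.castSucc) * ‖v (Fin.last m)‖ := by
          rw [h_split, ← N.nrm_one (v (Fin.last m))]
          exact N.nrm_mul_le _ _ _ _
      _ ≤ ∏ i, ‖v i‖ := by
          rw [Fin.prod_univ_castSucc]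
          gcongr
          exact ih _

/-- The identity map from the algebraic tensor power to the normed tensor power. -/
def toTensorPow (m : ℕ) : ⨂[ℝ]^m E →ₗ[ℝ] TensorPow N m := LinearMap.id

theorem continuous_tensorExp (m : ℕ) :
    Continuous fun v : E => toTensorPow N m (tensorExp v m) := by
  let t : MultilinearMap ℝ (fun _ : Fin m => E) (TensorPow N m) :=
    (toTensorPow N m).compMultilinearMap (PiTensorProduct.tprod ℝ)
  have h_cont : Continuous t := (t.mkContinuous 1 fun v => by
    rw [one_mul]
    exact nrm_tprod_le N v).cont
  exact (h_cont.comp (continuous_pi fun _ => continuous_id)).const_smul ((m ! : ℝ)⁻¹)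

/-- The tensor product as a continuous bilinear map between normed tensor powers. -/
def tensorMul (i j : ℕ) : TensorPow N i →L[ℝ] TensorPow N j →L[ℝ] TensorPow N (i + j) :=
  LinearMap.mkContinuous₂
    (show TensorPow N i →ₗ[ℝ] TensorPow N j →ₗ[ℝ] TensorPow N (i + j) from
      (TensorProduct.mk ℝ (⨂[ℝ]^i E) (⨂[ℝ]^j E)).compr₂
        ((toTensorPow N (i + j)).comp TensorPower.mulEquiv.toLinearMap))
    1 fun a b => by
      rw [one_mul]
      exact N.nrm_mul_le i j a b

variable {X : Type*} [TopologicalSpace X]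

theorem continuous_tensorConv {s t : X → (m : ℕ) → ⨂[ℝ]^m E}
    (hs : ∀ m, Continuous fun x => toTensorPow N m (s x m))
    (ht : ∀ m, Continuous fun x => toTensorPow N m (t x m)) (m : ℕ) :
    Continuous fun x => toTensorPow N m (tensorConv (s x) (t x) m) := by
  have h_cast {k : ℕ} (h : k = m) {a : X → ⨂[ℝ]^k E}
      (ha : Continuous fun x => toTensorPow N k (a x)) :
      Continuous fun x => toTensorPow N m (TensorPower.cast ℝ E h (a x)) := by
    subst h
    simpa only [TensorPower.cast_refl, LinearEquiv.refl_apply] using ha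
  simp only [tensorConv, map_sum]
  exact continuous_finsetSum _ fun p _ => h_cast _ <|
    ((tensorMul N p.1.1 p.1.2).continuous.comp (hs p.1.1)).clm_apply (ht p.1.2)

/-- Families of tensor series that are continuous in each degree and whose norms are locally
dominated by a summable sequence; such families are continuous for the norm of `TensorSeries N`. -/
structure IsLocallyDominated (s : X → (m : ℕ) → ⨂[ℝ]^m E) : Prop where
  continuous_apply : ∀ m, Continuous fun x => toTensorPow N m (s x m)
  exists_summable_bound : ∀ x₀, ∃ b : ℕ → ℝ, Summable b ∧ ∀ᶠ x in 𝓝 x₀, ∀ m, N.nrm m (s x m) ≤ b m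

variable {N}

theorem isLocallyDominated_tensorOne :
    IsLocallyDominated N fun _ : X => (tensorOne : (m : ℕ) → ⨂[ℝ]^m E) :=
  ⟨fun _ => continuous_const, fun _ =>
    ⟨_, summable_tensorOne N, Eventually.of_forall fun _ _ => le_rfl⟩⟩

theorem isLocallyDominated_tensorExp {f : X → E} (hf : Continuous f) :
    IsLocallyDominated N fun x => tensorExp (f x) := by
  refine ⟨fun m => (continuous_tensorExp N m).comp hf, fun x₀ =>
    ⟨_, Real.summable_pow_div_factorial (‖f x₀‖ + 1), ?_⟩⟩
  filter_upwards [hf.norm.continuousAt.eventually_lt_const (lt_add_one ‖f x₀‖)] with x hx m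
  rw [tensorExp, map_smul_eq_mul, Real.norm_of_nonneg (by positivity), div_eq_inv_mul]
  gcongr
  exact (nrm_pow_le N _ m).trans (by gcongr)

theorem IsLocallyDominated.tensorConv {s t : X → (m : ℕ) → ⨂[ℝ]^m E}
    (hs : IsLocallyDominated N s) (ht : IsLocallyDominated N t) :
    IsLocallyDominated N fun x => tensorConv (s x) (t x) := by
  refine ⟨continuous_tensorConv N hs.continuous_apply ht.continuous_apply, fun x₀ => ?_⟩
  obtain ⟨b, hb, h_sb⟩ := hs.exists_summable_bound x₀
  obtain ⟨c, hc, h_tc⟩ := ht.exists_summable_bound x₀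
  have hb₀ : 0 ≤ b := fun m => (apply_nonneg (N.nrm m) _).trans (h_sb.self_of_nhds m)
  have hc₀ : 0 ≤ c := fun m => (apply_nonneg (N.nrm m) _).trans (h_tc.self_of_nhds m)
  refine ⟨_, summable_antidiagonal_mul hb hc hb₀ hc₀, ?_⟩
  filter_upwards [h_sb, h_tc] with x hsx htx m
  exact (nrm_tensorConv_le N _ _ m).trans <| Finset.sum_le_sum fun p _ =>
    mul_le_mul (hsx _) (htx _) (apply_nonneg _ _) (hb₀ _)

theorem isLocallyDominated_expProduct {n : ℕ} {v : Fin n → X → E} (hv : ∀ t, Continuous (v t)) :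
    IsLocallyDominated N fun x => expProduct fun t => v t x := by
  induction n with
  | zero => exact isLocallyDominated_tensorOne
  | succ n ih =>
    simp only [expProduct_succ]
    exact (isLocallyDominated_tensorExp (hv 0)).tensorConv (ih fun t => hv t.succ)

theorem norm_sub_eq_tsum_of_apply_eq_incl {s t : (m : ℕ) → ⨂[ℝ]^m E} {S S' : TensorSeries N}
    (hS : ∀ m, S m = TensorPow.incl N m (s m)) (hS' : ∀ m, S' m = TensorPow.incl N m (t m)) :
    ‖S - S'‖ = ∑' m, ‖toTensorPow N m (s m) - toTensorPow N m (t m)‖ := by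
  rw [lp.norm_eq_tsum_rpow (by simp)]
  simp only [ENNReal.toReal_one, Real.rpow_one, div_one]
  refine tsum_congr fun m => ?_
  rw [lp.coeFn_sub, Pi.sub_apply, hS, hS', ← UniformSpace.Completion.norm_coe (E := TensorPow N m),
    UniformSpace.Completion.coe_sub]
  rfl

theorem IsLocallyDominated.continuous {s : X → (m : ℕ) → ⨂[ℝ]^m E}
    (hs : IsLocallyDominated N s) {S : X → TensorSeries N}
    (hS : ∀ x m, S x m = TensorPow.incl N m (s x m)) : Continuous S := by
  refine continuous_iff_continuousAt.2 fun x₀ => ?_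
  rw [ContinuousAt, tendsto_iff_norm_sub_tendsto_zero]
  simp only [fun x => norm_sub_eq_tsum_of_apply_eq_incl (hS x) (hS x₀)]
  obtain ⟨b, hb, h_sb⟩ := hs.exists_summable_bound x₀
  rw [← tsum_zero (α := ℝ) (β := ℕ)]
  refine tendsto_tsum_of_dominated_convergence (hb.add hb) (fun m => ?_) ?_
  · exact tendsto_iff_norm_sub_tendsto_zero.1 (hs.continuous_apply m).continuousAt
  · filter_upwards [h_sb] with x hx m
    rw [norm_norm]
    exact norm_sub_le_of_le (hx m) (h_sb.self_of_nhds m)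

variable {T : ℕ} {W : Type u} [NormedAddCommGroup W] [NormedSpace ℝ W]

theorem continuous_increment (t : Fin (T + 1)) : Continuous fun x : DPath T W => increment x t := by
  have h_eval (s : Fin (T + 1)) : Continuous fun x : DPath T W => x s :=
    continuous_apply (A := fun _ : Fin (T + 1) => W) s
  refine (WithLp.prod_continuous_toLp 1 ℝ W).comp (continuous_const.prodMk ?_)
  exact Fin.cases (h_eval 0) (fun s => (h_eval s.succ).sub (h_eval s.castSucc)) t

theorem continuous_signature (N : AdmissibleNorms (TimeExt W)) :
    Continuous (signature N : DPath T W → UnitTensorSeries N) :=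
  ((isLocallyDominated_expProduct continuous_increment).continuous fun _ _ => rfl).subtype_mk _

theorem continuous_robustSignature (c : SignatureScheme W) :
    Continuous (robustSignature c : DPath T W → TensorSeries c.norms) :=
  c.normalization.continuous_toFun.comp (continuous_signature c.norms)

end SignatureContinuity

section Shuffle

variable {α R : Type*}

/-- The list of all shuffles of two words, with multiplicity. -/
def wordShuffles : List α → List α → List (List α)
  | [], w => [w]
  | a :: u, [] => [a :: u]
  | a :: u, b :: w => (wordShuffles u (b :: w)).map (List.cons a) ++
      (wordShuffles (a :: u) w).map (List.cons b)
termination_by u w => u.length + w.length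

theorem length_of_mem_wordShuffles {u w v : List α} (hv : v ∈ wordShuffles u w) :
    v.length = u.length + w.length := by
  induction u, w using wordShuffles.induct generalizing v with
  | case1 w => simp_all [wordShuffles]
  | case2 a u => simp_all [wordShuffles]
  | case3 a u b w ih_left ih_right =>
    rw [wordShuffles, List.mem_append, List.mem_map, List.mem_map] at hv
    rcases hv with ⟨v, hv, rfl⟩ | ⟨v, hv, rfl⟩
    · simp only [List.length_cons, ih_left hv]
      omega
    · simp only [List.length_cons, ih_right hv]
      omega

section AddMonoid

variable [AddMonoid R]

/-- The sum of a function on words over the shuffles of two words: the value on the shuffle product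
`u ⧢ w` of the linear extension of the function. -/
def shuffleSum (f : List α → R) (u w : List α) : R := ((wordShuffles u w).map f).sum

theorem shuffleSum_nil_left (f : List α → R) : shuffleSum f [] = f := by
  funext w
  simp [shuffleSum, wordShuffles]

theorem shuffleSum_nil_right (f : List α → R) (u : List α) : shuffleSum f u [] = f u := by
  cases u <;> simp [shuffleSum, wordShuffles]

theorem shuffleSum_cons_cons (f : List α → R) (a b : α) (u w : List α) :
    shuffleSum f (a :: u) (b :: w) =
      shuffleSum (fun v => f (a :: v)) u (b :: w) +
        shuffleSum (fun v => f (b :: v)) (a :: u) w := by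
  rw [shuffleSum, wordShuffles, List.map_append, List.sum_append, List.map_map, List.map_map]
  rfl

end AddMonoid

section Semiring

variable [Semiring R]

theorem shuffleSum_add (f g : List α → R) (u w : List α) :
    shuffleSum (fun v => f v + g v) u w = shuffleSum f u w + shuffleSum g u w :=
  List.sum_map_add

theorem shuffleSum_const_mul (c : R) (f : List α → R) (u w : List α) :
    shuffleSum (fun v => c * f v) u w = c * shuffleSum f u w :=
  List.sum_map_mul_left _ _ _

/-- The convolution of functions on words dual to deconcatenation:
`wordConv f g w = ∑ f u * g v` over all splittings `w = u ++ v`. -/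
def wordConv (f g : List α → R) : List α → R
  | [] => f [] * g []
  | a :: w => f [] * g (a :: w) + wordConv (fun v => f (a :: v)) g w

theorem wordConv_cons (f g : List α → R) (a : α) (w : List α) :
    wordConv f g (a :: w) = f [] * g (a :: w) + wordConv (fun v => f (a :: v)) g w :=
  rfl

theorem wordConv_add (f f' g : List α → R) (w : List α) :
    wordConv (fun v => f v + f' v) g w = wordConv f g w + wordConv f' g w := by
  induction w generalizing f f' with
  | nil => exact add_mul _ _ _
  | cons a w ih => simp only [wordConv_cons, ih, add_mul, add_add_add_comm]

theorem wordConv_const_mul (c : R) (f g : List α → R) (w : List α) :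
    wordConv (fun v => c * f v) g w = c * wordConv f g w := by
  induction w generalizing f with
  | nil => exact mul_assoc _ _ _
  | cons a w ih => simp only [wordConv_cons, ih, mul_add, mul_assoc]

theorem wordConv_eq_sum (f g : List α → R) (w : List α) :
    wordConv f g w = ∑ p ∈ Finset.HasAntidiagonal.antidiagonal w.length,
      f (w.take p.1) * g (w.drop p.1) := by
  induction w generalizing f with
  | nil => simp [wordConv]
  | cons a w ih =>
    rw [List.length_cons, Finset.Nat.antidiagonal_succ, Finset.sum_cons, Finset.sum_map,
      wordConv_cons, ih]
    rfl

theorem wordConv_replicate_append_singleton (f g : List α → R) (a l : α) (n : ℕ) :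
    wordConv f g (List.replicate n a ++ [l]) =
      ∑ i ∈ Finset.range (n + 1), f (List.replicate i a) * g (List.replicate (n - i) a ++ [l]) +
        f (List.replicate n a ++ [l]) * g [] := by
  induction n generalizing f with
  | zero => simp [wordConv]
  | succ n ih =>
    rw [List.replicate_succ, List.cons_append, wordConv_cons, ih,
      Finset.sum_range_succ' _ (n + 1)]
    simp only [List.replicate_succ, List.cons_append, Nat.add_sub_add_right, List.replicate_zero,
      Nat.sub_zero]
    abel

/-- Functions on words that are multiplicative for the shuffle product, such as the coordinates of
group-like tensor series. -/
structure IsShuffleCharacter (f : List α → R) : Prop where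
  nil : f [] = 1
  shuffle : ∀ u w, shuffleSum f u w = f u * f w

end Semiring

section CommSemiring

variable [CommSemiring R]

/- The bialgebra identity: the shuffle product, dual to `shuffleSum`, and the deconcatenation
coproduct, dual to `wordConv`, are compatible. -/
theorem shuffleSum_wordConv (f : List α → R) {g : List α → R} (hg : IsShuffleCharacter g)
    (u w : List α) : shuffleSum (wordConv f g) u w =
      wordConv (fun u' => wordConv (shuffleSum f u') g w) g u := by
  induction u, w using wordShuffles.induct generalizing f with
  | case1 w => simp [wordConv, shuffleSum_nil_left, hg.nil]
  | case2 a u =>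
    rw [shuffleSum_nil_right]
    simp only [wordConv, shuffleSum_nil_right, hg.nil, mul_one]
  | case3 a u b w ih_left ih_right =>
    have h_cons (u' : List α) : wordConv (shuffleSum f (a :: u')) g (b :: w) =
        wordConv (shuffleSum (fun v => f (a :: v)) u') g (b :: w) +
          wordConv (shuffleSum (fun v => f (b :: v)) (a :: u')) g w := by
      simp only [wordConv_cons, shuffleSum_nil_right, shuffleSum_cons_cons, wordConv_add]
      ring
    have h_g := hg.shuffle (a :: u) (b :: w)
    rw [shuffleSum_cons_cons] at h_g
    calc shuffleSum (wordConv f g) (a :: u) (b :: w)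
        = f [] * (g (a :: u) * g (b :: w)) +
            (wordConv (fun u' => wordConv (shuffleSum (fun v => f (a :: v)) u') g (b :: w)) g u +
              wordConv (fun u' => wordConv (shuffleSum (fun v => f (b :: v)) u') g w) g
                (a :: u)) := by
          rw [shuffleSum_cons_cons, ← h_g, ← ih_left, ← ih_right]
          simp only [wordConv_cons, shuffleSum_add, shuffleSum_const_mul]
          ring
      _ = wordConv (fun u' => wordConv (shuffleSum f u') g (b :: w)) g (a :: u) := by
          simp only [wordConv_cons _ _ a, h_cons, wordConv_add, shuffleSum_nil_left,
            wordConv_cons f g b]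
          ring

theorem IsShuffleCharacter.wordConv {f g : List α → R} (hf : IsShuffleCharacter f)
    (hg : IsShuffleCharacter g) : IsShuffleCharacter (wordConv f g) := by
  refine ⟨by simp [_root_.wordConv, hf.nil, hg.nil], fun u w => ?_⟩
  rw [shuffleSum_wordConv f hg]
  have h_inner (u' : List α) : _root_.wordConv (shuffleSum f u') g w =
      _root_.wordConv f g w * f u' := by
    simp only [funext (hf.shuffle u'), wordConv_const_mul, mul_comm]
  rw [funext h_inner, wordConv_const_mul, mul_comm]

theorem IsShuffleCharacter.pow_length_mul {f : List α → R} (hf : IsShuffleCharacter f) (c : R) :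
    IsShuffleCharacter fun v => c ^ v.length * f v := by
  refine ⟨by simp [hf.nil], fun u w => ?_⟩
  calc shuffleSum (fun v => c ^ v.length * f v) u w
      = shuffleSum (fun v => c ^ (u.length + w.length) * f v) u w :=
        congrArg List.sum <| List.map_congr_left fun v hv => by
          rw [length_of_mem_wordShuffles hv]
    _ = c ^ u.length * f u * (c ^ w.length * f w) := by
        rw [shuffleSum_const_mul, hf.shuffle, pow_add]
        ring

theorem shuffleSum_prod_mul_length (x : α → R) (g : ℕ → R) (u w : List α) :
    shuffleSum (fun v => (v.map x).prod * g v.length) u w =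
      (u.map x).prod * (w.map x).prod * ((u.length + w.length).choose u.length *
        g (u.length + w.length)) := by
  induction u, w using wordShuffles.induct generalizing g with
  | case1 w => simp [shuffleSum_nil_left]
  | case2 a u => simp [shuffleSum_nil_right]
  | case3 a u b w ih_left ih_right =>
    simp only [shuffleSum_cons_cons, List.map_cons, List.prod_cons, List.length_cons, mul_assoc,
      shuffleSum_const_mul]
    rw [ih_left fun n => g (n + 1), ih_right fun n => g (n + 1)]
    have h_left : u.length + (w.length + 1) = u.length + w.length + 1 := by ring
    have h_right : u.length + 1 + w.length = u.length + w.length + 1 := by ring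
    have h_both : u.length + 1 + (w.length + 1) = u.length + w.length + 1 + 1 := by ring
    simp only [List.map_cons, List.prod_cons, List.length_cons, h_left, h_right, h_both,
      Nat.choose_succ_succ (u.length + w.length + 1) u.length]
    push_cast
    ring

end CommSemiring

theorem isShuffleCharacter_prod_mul_inv_factorial [Field R] [CharZero R] (x : α → R) :
    IsShuffleCharacter fun v : List α => (v.map x).prod * ((v.length)! : R)⁻¹ := by
  refine ⟨by simp, fun u w => ?_⟩
  have h_fact (n : ℕ) : (n ! : R) ≠ 0 := Nat.cast_ne_zero.2 n.factorial_ne_zero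
  rw [shuffleSum_prod_mul_length x (fun n => (n ! : R)⁻¹), Nat.cast_add_choose]
  field_simp [h_fact]

end Shuffle

section Pairing

variable {E : Type u} [NormedAddCommGroup E] [NormedSpace ℝ E]

/-- The elementary functional `l 0 ⊗ ⋯ ⊗ l (m - 1)` on the `m`-th tensor power. -/
def elementaryFunctional (l : ℕ → (E →L[ℝ] ℝ)) (m : ℕ) : ⨂[ℝ]^m E →ₗ[ℝ] ℝ :=
  PiTensorProduct.lift ((MultilinearMap.mkPiAlgebra ℝ (Fin m) ℝ).compLinearMap
    fun i => (l i : E →ₗ[ℝ] ℝ))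

theorem elementaryFunctional_tprod (l : ℕ → (E →L[ℝ] ℝ)) {m : ℕ} (v : Fin m → E) :
    elementaryFunctional l m (PiTensorProduct.tprod ℝ v) = ∏ i : Fin m, l i (v i) := by
  simp [elementaryFunctional]

theorem elementaryFunctional_congr {l l' : ℕ → (E →L[ℝ] ℝ)} {m : ℕ}
    (h : ∀ i < m, l i = l' i) : elementaryFunctional l m = elementaryFunctional l' m := by
  simp only [elementaryFunctional, fun i : Fin m => h i i.2]

theorem elementaryFunctional_mul (l : ℕ → (E →L[ℝ] ℝ)) {i j : ℕ} (a : ⨂[ℝ]^i E) (b : ⨂[ℝ]^j E) :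
    elementaryFunctional l (i + j) (TensorPower.mulEquiv (a ⊗ₜ[ℝ] b)) =
      elementaryFunctional l i a * elementaryFunctional (fun k => l (i + k)) j b := by
  induction a using PiTensorProduct.induction_on with
  | smul_tprod r v =>
    induction b using PiTensorProduct.induction_on with
    | smul_tprod s v' =>
      rw [TensorProduct.smul_tmul_smul, map_smul, map_smul, map_smul, map_smul,
        ← TensorPower.gMul_def, TensorPower.tprod_mul_tprod, elementaryFunctional_tprod,
        elementaryFunctional_tprod, elementaryFunctional_tprod, Fin.prod_univ_add]
      simp only [Fin.append_left, Fin.append_right, Fin.val_castAdd, Fin.val_natAdd, smul_eq_mul]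
      ring
    | add b b' hb hb' => rw [TensorProduct.tmul_add, map_add, map_add, map_add, hb, hb', mul_add]
  | add a a' ha ha' => rw [TensorProduct.add_tmul, map_add, map_add, map_add, ha, ha', add_mul]

theorem elementaryFunctional_cast (l : ℕ → (E →L[ℝ] ℝ)) {m n : ℕ} (h : m = n) (a : ⨂[ℝ]^m E) :
    elementaryFunctional l n (TensorPower.cast ℝ E h a) = elementaryFunctional l m a := by
  subst h
  rw [TensorPower.cast_refl]
  rfl

/-- The coordinate of a tensor series along a word `l₀ ⋯ l_{m-1}` of functionals, that is, the value
of `l₀ ⊗ ⋯ ⊗ l_{m-1}` on its component of degree `m`. -/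
def wordPairing (s : (m : ℕ) → ⨂[ℝ]^m E) (w : List (E →L[ℝ] ℝ)) : ℝ :=
  elementaryFunctional (fun i => w.getD i 0) w.length (s w.length)

theorem wordPairing_tensorExp (v : E) (w : List (E →L[ℝ] ℝ)) :
    wordPairing (tensorExp v) w = (w.map fun l => l v).prod * ((w.length)! : ℝ)⁻¹ := by
  have h_prod : ∏ i : Fin w.length, w.getD i 0 v = (w.map fun l => l v).prod := by
    rw [← List.prod_ofFn]
    exact congrArg List.prod <| List.ext_getElem (by simp) fun i _ _ => by simp
  rw [wordPairing, tensorExp, map_smul, elementaryFunctional_tprod, h_prod, smul_eq_mul, mul_comm]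

theorem tensorOne_eq_tensorExp_zero : (tensorOne : (m : ℕ) → ⨂[ℝ]^m E) = tensorExp 0 := by
  funext m
  cases m with
  | zero => exact (tensorExp_zero 0).symm
  | succ m =>
    rw [tensorExp, MultilinearMap.map_coord_zero _ 0 rfl, smul_zero]
    rfl

theorem wordPairing_tensorConv (s t : (m : ℕ) → ⨂[ℝ]^m E) :
    wordPairing (tensorConv s t) = wordConv (wordPairing s) (wordPairing t) := by
  funext w
  rw [wordConv_eq_sum, wordPairing, tensorConv, map_sum,
    ← Finset.sum_coe_sort (Finset.HasAntidiagonal.antidiagonal w.length)]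
  refine Finset.sum_congr rfl ?_
  rintro ⟨⟨i, j⟩, hp⟩ -
  have hij : i + j = w.length := Finset.HasAntidiagonal.mem_antidiagonal.mp hp
  have hi : (w.take i).length = i := by rw [List.length_take]; omega
  have hj : (w.drop i).length = j := by rw [List.length_drop]; omega
  rw [elementaryFunctional_cast, elementaryFunctional_mul, wordPairing, wordPairing, hi, hj]
  congr 1
  · refine LinearMap.congr_fun (elementaryFunctional_congr fun k hk => ?_) _
    simp [List.getD_eq_getElem?_getD, hk]
  · refine LinearMap.congr_fun (elementaryFunctional_congr fun k _ => ?_) _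
    simp [List.getD_eq_getElem?_getD, List.getElem?_drop]

theorem isShuffleCharacter_tensorExp (v : E) : IsShuffleCharacter (wordPairing (tensorExp v)) := by
  simpa only [← wordPairing_tensorExp] using
    isShuffleCharacter_prod_mul_inv_factorial fun l : E →L[ℝ] ℝ => l v

theorem isShuffleCharacter_expProduct {n : ℕ} (v : Fin n → E) :
    IsShuffleCharacter (wordPairing (expProduct v)) := by
  induction n with
  | zero =>
    rw [expProduct_zero, tensorOne_eq_tensorExp_zero]
    exact isShuffleCharacter_tensorExp 0
  | succ n ih =>
    rw [expProduct_succ, wordPairing_tensorConv]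
    exact (isShuffleCharacter_tensorExp _).wordConv (ih _)

theorem add_one_pow_sub_add_one_pow_div_factorial {K : Type*} [Field K] [CharZero K] (n : ℕ)
    (x y : K) :
    ((x + 1) ^ (n + 1) - (y + 1) ^ (n + 1)) / ((n + 1)! : K) =
      ∑ i ∈ Finset.range (n + 1),
        (i ! : K)⁻¹ * ((x ^ (n - i + 1) - y ^ (n - i + 1)) / ((n - i + 1)! : K)) := by
  rw [add_pow, add_pow, ← Finset.sum_sub_distrib, Finset.sum_range_succ', ← Finset.sum_flip]
  simp only [one_pow, mul_one, pow_zero, sub_self, add_zero, Finset.sum_div]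
  refine Finset.sum_congr rfl fun i hi => ?_
  have hi : i ≤ n := Nat.lt_succ_iff.1 (Finset.mem_range.1 hi)
  have h_fact (m : ℕ) : (m ! : K) ≠ 0 := Nat.cast_ne_zero.2 m.factorial_ne_zero
  rw [Nat.cast_choose K (show n - i + 1 ≤ n + 1 by omega),
    show n + 1 - (n - i + 1) = i by omega]
  field_simp [h_fact]

theorem wordPairing_expProduct {τ : E →L[ℝ] ℝ} (l : E →L[ℝ] ℝ) {n : ℕ} {v : Fin n → E}
    (hτ : ∀ t, τ (v t) = 1) (k : ℕ) :
    wordPairing (expProduct v) (List.replicate k τ ++ [l]) =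
      ∑ t : Fin n, l (v t) * ((((t : ℕ) + 1 : ℝ) ^ (k + 1) - (t : ℕ) ^ (k + 1)) /
        ((k + 1)! : ℝ)) := by
  induction n generalizing k with
  | zero => simp [expProduct_zero, tensorOne_eq_tensorExp_zero, wordPairing_tensorExp]
  | succ n ih =>
    rw [expProduct_succ, wordPairing_tensorConv, wordConv_replicate_append_singleton,
      Fin.sum_univ_succ, (isShuffleCharacter_expProduct _).nil, add_comm]
    congr 1
    · simp [wordPairing_tensorExp, hτ, div_eq_mul_inv]
    · simp only [ih fun t => hτ t.succ, wordPairing_tensorExp, List.map_replicate, hτ,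
        List.prod_replicate, one_pow, one_mul, List.length_replicate, Finset.mul_sum]
      rw [Finset.sum_comm]
      refine Finset.sum_congr rfl fun t _ => ?_
      rw [Fin.val_succ]
      push_cast
      rw [add_one_pow_sub_add_one_pow_div_factorial, Finset.mul_sum]
      exact Finset.sum_congr rfl fun i _ => mul_left_comm _ _ _

/-- An elementary functional as a continuous functional on the normed tensor power. -/
def elementaryCLM (N : AdmissibleNorms E) (l : ℕ → (E →L[ℝ] ℝ)) (m : ℕ) : TensorPow N m →L[ℝ] ℝ :=
  LinearMap.mkContinuousOfExistsBound (show TensorPow N m →ₗ[ℝ] ℝ from elementaryFunctional l m)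
    (N.continuous_elementary m fun i => l i)

/-- The extension of an elementary functional to the completed tensor power. -/
def completedElementaryCLM (N : AdmissibleNorms E) (l : ℕ → (E →L[ℝ] ℝ)) (m : ℕ) :
    UniformSpace.Completion (TensorPow N m) →L[ℝ] ℝ :=
  (elementaryCLM N l m).extend UniformSpace.Completion.toComplL

theorem completedElementaryCLM_incl (N : AdmissibleNorms E) (l : ℕ → (E →L[ℝ] ℝ)) {m : ℕ}
    (a : ⨂[ℝ]^m E) :
    completedElementaryCLM N l m (TensorPow.incl N m a) = elementaryFunctional l m a :=
  (elementaryCLM N l m).extend_eq (e := UniformSpace.Completion.toComplL)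
    UniformSpace.Completion.denseRange_coe (UniformSpace.Completion.isUniformInducing_coe _) a

/-- The coordinate along a word of functionals, extended to a continuous functional on the completed
tensor algebra. -/
def wordFunctional (N : AdmissibleNorms E) (w : List (E →L[ℝ] ℝ)) : TensorSeries N →L[ℝ] ℝ :=
  (completedElementaryCLM N (fun i => w.getD i 0) w.length).comp
    (lp.evalCLM ℝ _ 1 w.length)

theorem wordFunctional_apply (N : AdmissibleNorms E) (w : List (E →L[ℝ] ℝ)) (S : TensorSeries N) :
    wordFunctional N w S =
      completedElementaryCLM N (fun i => w.getD i 0) w.length (S w.length) :=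
  rfl

variable {T : ℕ} {W : Type u} [NormedAddCommGroup W] [NormedSpace ℝ W]

theorem wordFunctional_robustSignature (c : SignatureScheme W) (x : DPath T W)
    (w : List (TimeExt W →L[ℝ] ℝ)) :
    wordFunctional c.norms w (robustSignature c x) =
      c.normalization.scale (signature c.norms x) ^ w.length *
        wordPairing (expProduct (increment x)) w := by
  rw [wordFunctional_apply, robustSignature, c.normalization.toFun_apply, map_smul, smul_eq_mul]
  exact congrArg _ (completedElementaryCLM_incl c.norms _ _)

theorem isShuffleCharacter_robustSignature (c : SignatureScheme W) (x : DPath T W) :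
    IsShuffleCharacter fun w => wordFunctional c.norms w (robustSignature c x) := by
  simp only [wordFunctional_robustSignature]
  exact (isShuffleCharacter_expProduct _).pow_length_mul _

end Pairing

section Separation

theorem eq_zero_of_forall_sum_mul_pow_sub_pow_eq_zero {K : Type*} [Field K] [CharZero K] {n : ℕ}
    {v : Fin n → K} (h : ∀ k : ℕ, ∑ t : Fin n, v t * (((t : ℕ) + 1 : K) ^ (k + 1) -
      (t : ℕ) ^ (k + 1)) = 0) : v = 0 := by
  have h_poly (p : Polynomial K) :
      ∑ t : Fin n, v t * (p.eval (((t : ℕ) + 1 : ℕ) : K) - p.eval ((t : ℕ) : K)) = 0 := by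
    induction p using Polynomial.induction_on' with
    | add p q hp hq =>
      simp only [Polynomial.eval_add, add_sub_add_comm, mul_add, Finset.sum_add_distrib, hp, hq,
        add_zero]
    | monomial k a =>
      cases k with
      | zero => simp
      | succ k =>
        simp only [Polynomial.eval_monomial, ← mul_sub, mul_left_comm _ a, ← Finset.mul_sum,
          Nat.cast_succ, h, mul_zero]
  funext t₀
  -- Test with the polynomial that interpolates the indicator of `{i | t₀ < i}` on `0, …, n`.
  let step (i : ℕ) : K := if (t₀ : ℕ) < i then 1 else 0
  obtain ⟨p, h_eval⟩ : ∃ p : Polynomial K, ∀ i ≤ n, p.eval (i : K) = step i :=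
    ⟨Lagrange.interpolate (Finset.range (n + 1)) (fun i : ℕ => (i : K)) step, fun i hi =>
      Lagrange.eval_interpolate_at_node step (v := fun i : ℕ => (i : K)) Nat.cast_injective.injOn
        (Finset.mem_range.2 (Nat.lt_succ_of_le hi))⟩
  have h_jump (t : Fin n) : p.eval (((t : ℕ) + 1 : ℕ) : K) - p.eval ((t : ℕ) : K) =
      if t = t₀ then 1 else 0 := by
    rw [h_eval _ t.2, h_eval _ t.2.le]
    simp only [step, Fin.ext_iff]
    split_ifs <;> first | omega | simp
  simpa only [h_jump, mul_ite, mul_one, mul_zero, Finset.sum_ite_eq', Finset.mem_univ, if_true,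
    Pi.zero_apply] using h_poly p

theorem eq_of_wordPairing_expProduct_eq {E : Type u} [NormedAddCommGroup E] [NormedSpace ℝ E]
    {τ : E →L[ℝ] ℝ} {n : ℕ} {v v' : Fin n → E} (hv : ∀ t, τ (v t) = 1) (hv' : ∀ t, τ (v' t) = 1)
    (h : wordPairing (expProduct v) = wordPairing (expProduct v')) : v = v' := by
  suffices h_dual : ∀ l : E →L[ℝ] ℝ, (fun t => l (v t) - l (v' t)) = 0 from
    funext fun t => (SeparatingDual.eq_iff_forall_dual_eq (R := ℝ)).2 fun l =>
      sub_eq_zero.1 (congrFun (h_dual l) t)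
  refine fun l => eq_zero_of_forall_sum_mul_pow_sub_pow_eq_zero fun k => ?_
  have h_fact : ((k + 1)! : ℝ) ≠ 0 := Nat.cast_ne_zero.2 (Nat.factorial_ne_zero _)
  have h_word := congrFun h (List.replicate k τ ++ [l])
  rw [wordPairing_expProduct l hv, wordPairing_expProduct l hv', ← sub_eq_zero,
    ← Finset.sum_sub_distrib] at h_word
  simp only [← sub_mul] at h_word
  simpa only [← mul_div_assoc, ← Finset.sum_div, div_eq_zero_iff, h_fact, or_false] using h_word

variable {T : ℕ} {W : Type u} [NormedAddCommGroup W] [NormedSpace ℝ W]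

theorem injective_increment :
    Function.Injective (increment : DPath T W → Fin (T + 1) → TimeExt W) := by
  intro x y h
  have h_snd (t : Fin (T + 1)) : (increment x t).snd = (increment y t).snd :=
    congrArg WithLp.snd (congrFun h t)
  funext t
  induction t using Fin.induction with
  | zero => exact h_snd 0
  | succ s ih => exact sub_left_injective ((h_snd s.succ).trans (congrArg (y s.succ - ·) ih.symm))

theorem eq_of_forall_wordFunctional_robustSignature_eq (c : SignatureScheme W) {x y : DPath T W}
    (h : ∀ w, wordFunctional c.norms w (robustSignature c x) =
      wordFunctional c.norms w (robustSignature c y)) : x = y := by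
  simp only [wordFunctional_robustSignature] at h
  let τ : TimeExt W →L[ℝ] ℝ := WithLp.fstL 1 ℝ ℝ W
  have hτ (z : DPath T W) (t : Fin (T + 1)) : τ (increment z t) = 1 := rfl
  -- The first time coordinate of every signature is `T + 1`, which determines the scale.
  have h_time (z : DPath T W) : wordPairing (expProduct (increment z)) [τ] = T + 1 := by
    simpa [hτ] using wordPairing_expProduct τ (hτ z) 0
  have h_scale : c.normalization.scale (signature c.norms x) =
      c.normalization.scale (signature c.norms y) := by
    have h_ne : (T + 1 : ℝ) ≠ 0 := by positivity
    simpa [h_time, h_ne] using h [τ]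
  refine injective_increment (eq_of_wordPairing_expProduct_eq (hτ x) (hτ y) (funext fun w => ?_))
  exact mul_left_cancel₀ (pow_ne_zero w.length (c.normalization.scale_pos _).ne') (h_scale ▸ h w)

end Separation

section ExpectedRobustSignature

open scoped BoundedContinuousFunction

variable {X : Type*} [TopologicalSpace X] {T : ℕ} {W : Type u} [NormedAddCommGroup W]
  [NormedSpace ℝ W] (c : SignatureScheme W)

/-- The robust signature of a path that depends continuously on a parameter, as a bounded continuous
function of the parameter. -/
def robustSignatureBCF {G : X → DPath T W} (hG : Continuous G) : X →ᵇ TensorSeries c.norms :=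
  BoundedContinuousFunction.ofNormedAddCommGroup (fun x => robustSignature c (G x))
    ((continuous_robustSignature c).comp hG) c.normalization.bounded_toFun.choose
    fun _ => c.normalization.bounded_toFun.choose_spec _

/-- The coordinate of `robustSignatureBCF` along a word of functionals. -/
def robustCoordinate {G : X → DPath T W} (hG : Continuous G) (w : List (TimeExt W →L[ℝ] ℝ)) :
    X →ᵇ ℝ :=
  (wordFunctional c.norms w).compLeftContinuousBounded X (robustSignatureBCF c hG)

theorem robustCoordinate_nil {G : X → DPath T W} (hG : Continuous G) :
    robustCoordinate c hG [] = 1 :=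
  BoundedContinuousFunction.ext fun x => (isShuffleCharacter_robustSignature c (G x)).nil

theorem robustCoordinate_mul {G : X → DPath T W} (hG : Continuous G)
    (u w : List (TimeExt W →L[ℝ] ℝ)) :
    robustCoordinate c hG u * robustCoordinate c hG w =
      shuffleSum (robustCoordinate c hG) u w := by
  ext x
  have h_sum : shuffleSum (robustCoordinate c hG) u w x =
      shuffleSum (fun v => robustCoordinate c hG v x) u w :=
    (map_list_sum (BoundedContinuousFunction.evalCLM ℝ x) _).trans
      (congrArg List.sum (List.map_map ..))
  exact ((isShuffleCharacter_robustSignature c (G x)).shuffle u w).symm.trans h_sum.symm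

theorem integral_robustCoordinate [MeasurableSpace X] [OpensMeasurableSpace X]
    [SecondCountableTopology X] {G : X → DPath T W} (hG : Continuous G)
    (w : List (TimeExt W →L[ℝ] ℝ)) (μ : Measure X) [IsFiniteMeasure μ] :
    ∫ x, robustCoordinate c hG w x ∂μ =
      wordFunctional c.norms w (∫ x, robustSignature c (G x) ∂μ) :=
  (wordFunctional c.norms w).integral_comp_comm
    (integrable_boundedContinuousFunction (robustSignatureBCF c hG) μ)

theorem continuous_integral_robustSignature [MeasurableSpace X] [OpensMeasurableSpace X]
    [TopologicalSpace.PseudoMetrizableSpace X] [SecondCountableTopology X] {G : X → DPath T W}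
    (hG : Continuous G) :
    Continuous fun μ : ProbabilityMeasure X => ∫ x, robustSignature c (G x) ∂(μ : Measure X) :=
  continuous_integral_probabilityMeasure (robustSignatureBCF c hG)

theorem injective_integral_robustSignature [PolishSpace X] [MeasurableSpace X] [BorelSpace X]
    {G : X → DPath T W} (hG : Continuous G) (h_inj : Function.Injective G) :
    Function.Injective fun μ : ProbabilityMeasure X =>
      ∫ x, robustSignature c (G x) ∂(μ : Measure X) := by
  intro μ ν h
  refine ProbabilityMeasure.toMeasure_injective <| eq_of_forall_integral_eq_of_span_mul_mem
    (F := robustCoordinate c hG) ?_ (fun u w => ?_) (fun x y hxy => ?_) fun w => ?_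
  · exact Submodule.subset_span ⟨[], robustCoordinate_nil c hG⟩
  · rw [robustCoordinate_mul]
    refine list_sum_mem fun f hf => ?_
    obtain ⟨v, -, rfl⟩ := List.mem_map.1 hf
    exact Submodule.subset_span (Set.mem_range_self v)
  · exact h_inj (eq_of_forall_wordFunctional_robustSignature_eq c hxy)
  · rw [integral_robustCoordinate, integral_robustCoordinate]
    exact congrArg (wordFunctional c.norms w) h

end ExpectedRobustSignature

section HigherRankSignature

variable (c : ℕ → (W : BanachSp.{u}) → SignatureScheme W) (T : ℕ) (V : Type u)
  [NormedAddCommGroup V] [NormedSpace ℝ V] [CompleteSpace V] [SecondCountableTopology V]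

theorem continuous_map_path {Y Z : Type u} [TopologicalSpace Y] [TopologicalSpace Z] {S : Y → Z}
    (hS : Continuous S) : Continuous fun x : DPath T Y => (fun t => S (x t) : DPath T Z) :=
  continuous_pi fun t => hS.comp (continuous_apply (A := fun _ : Fin (T + 1) => Y) t)

theorem continuous_expectedSignature : ∀ k, Continuous (expectedSignature c T V k)
  | 0 => continuous_id (X := V)
  | k + 1 => continuous_integral_robustSignature (c k (rankTensor c V k))
      (continuous_map_path T (continuous_expectedSignature k))

theorem injective_expectedSignature : ∀ k, Function.Injective (expectedSignature c T V k)
  | 0 => Function.injective_id (α := V)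
  | k + 1 => injective_integral_robustSignature (c k (rankTensor c V k))
      (continuous_map_path T (continuous_expectedSignature c T V k))
      (injective_expectedSignature k).comp_left

end HigherRankSignature

theorem proposition4p6 {V : Type u} [NormedAddCommGroup V] [NormedSpace ℝ V] [CompleteSpace V]
    [SecondCountableTopology V] (T : ℕ)
    (c : ℕ → (W : BanachSp.{u}) → SignatureScheme W) (r : ℕ)
    (X : ℕ → AdaptedProcess.{u, w} T V) (Y : AdaptedProcess.{u, w} T V) :
    (Tendsto X atTop (@nhds _ (extendedWeakTopology T V r) Y) →
      Tendsto (fun n => adaptedSigDist c r (X n) Y) atTop (𝓝 0)) ∧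
    ((∃ K : Set (AdaptedProcess.{u, w} T V),
        @IsCompact _ (extendedWeakTopology T V r) K ∧ ∀ n, X n ∈ K) →
      Tendsto (fun n => adaptedSigDist c r (X n) Y) atTop (𝓝 0) →
      Tendsto X atTop (@nhds _ (extendedWeakTopology T V r) Y)) := by
  let law : AdaptedProcess.{u, w} T V → rankProb T V (r + 1) := fun A => A.predictionLaw r
  let S : rankProb T V (r + 1) → rankTensor c V (r + 1) := expectedSignature c T V (r + 1)
  have h_cont : Continuous S := continuous_expectedSignature c T V (r + 1)
  have h_weak : Tendsto X atTop (@nhds _ (extendedWeakTopology T V r) Y) ↔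
      Tendsto (law ∘ X) atTop (𝓝 (law Y)) := by
    rw [nhds_induced, tendsto_comap_iff]
    rfl
  have h_dist : Tendsto (fun n => adaptedSigDist c r (X n) Y) atTop (𝓝 0) ↔
      Tendsto (S ∘ law ∘ X) atTop (𝓝 (S (law Y))) :=
    tendsto_iff_norm_sub_tendsto_zero.symm
  rw [h_weak, h_dist]
  refine ⟨(h_cont.tendsto _).comp, fun ⟨K, hK, hXK⟩ => ?_⟩
  have h_compact : IsCompact (law '' K) :=
    @IsCompact.image _ _ (extendedWeakTopology T V r) _ K law hK continuous_induced_dom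
  exact tendsto_of_continuous_injective_of_isCompact h_cont
    (injective_expectedSignature c T V (r + 1)) h_compact fun n => Set.mem_image_of_mem law (hXK n)

end
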